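/- **Setting.** Write $M\in\mathrm{GL}_4(\mathbb Q)$ in $2\times2$ blocks as $M=\begin{pmatrix}A_1&A_2\\A_3&A_4\end{pmatrix}$. It is of *Type I* if $\det A_1=\det A_4=1$ and $A_2=A_3=0$; of *Type II* if $\det A_2=\det A_3=1$ and $A_1=A_4=0$; of *Type III* if all $\det A_j\ne0$, $\det A_1=\det A_4$, $\det A_2=\det A_3$, $\det A_1+\det A_3=1$ and $(\det A_1)A_1^{-1}A_2=-(\det A_3)A_3^{-1}A_4$. Let $\mathfrak m_M(x)\in\mathbb Q[x]$ be the minimal polynomial of $M$ and let $\iota=\mathrm{diag}(1,1,-1,-1)$. A *generalized analytic holonomy set* $\mathcal X\in\mathfrak{Ghol}$ is a germ at $0$ of a surface in $\mathbb C^4$ (coordinates $(u_1,v_1,u_2,v_2)$) given by holomorphic functions $v_i(u_1,u_2)=\tau_iu_i+\sum_{l\ge3,\ l\text{ odd}}\sum_{j+k=l}c^i_{jk}u_1^ju_2^k$ $(i=1,2)$ such that: $\mathrm{Im}\,\tau_i>0$; $v_1(u_1,0)\not\equiv\tau_1u_1$ and $v_2(0,u_2)\not\equiv\tau_2u_2$;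 $v_1$ is odd in $u_1$ and even in $u_2$, and $v_2$ is even in $u_1$ and odd in $u_2$; $\partial v_1/\partial u_2=a\,\partial v_2/\partial u_1$ for some $a\in\mathbb C$; and every subgroup of $\mathrm{Aut}\,\mathcal X$ is finite, where $\mathrm{Aut}\,\mathcal X$ denotes here the group of all $M\in\mathrm{GL}_4(\mathbb Q)$ that map the germ $\mathcal X$ onto itself. The numbers $\tau_1,\tau_2$ are the *cusp shapes* of $\mathcal X$. **Theorem.** Let $\mathcal X\in\mathfrak{Ghol}$ have both cusp shapes in $\mathbb Q(\sqrt{-3})$, and let $\mathcal G$ be the subgroup of $\mathrm{Aut}\,\mathcal X$ generated by its elements of Types I, II and III. Suppose that $\mathcal G$ contains an element $M$ of Type III with $\mathfrak m_M(x)=x^3+2x^2+2x+1$ or $\mathfrak m_M(x)=x^3-2x^2+2x-1$. Then: 1. $\mathcal G=\langle M,\pm\iota\rangle$. 2. $\langle M,\pm\iota\rangle$ contains every element of Type III in $\mathrm{Aut}\,\mathcal X$, and every possible kind of Type III element occurs in $\mathcal G$: for each polynomial $x^2+1$, $x^3\pm1$, $x^3\pm2x^2+2x\pm1$ (equal signs),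 $x^2-1$, $x^2\pm x+1$, there is an $N\in\mathcal G$ of Type III having it as its minimal polynomial; there are $N\in\mathcal G$ of Type III with $\mathfrak m_N(x)=x^4+x^2+1$ and $N^2$ of Type III, and also with $\mathfrak m_N(x)=x^4+x^2+1$ and $N^2$ of Type I; and there is an $N\in\mathcal G$ of Type III with $\mathfrak m_N(x)=x^4-x^2+1$ and $N^2$ of Type I. 3. With $\eta:=(\iota M^5)(\iota M^2)$, $$\mathcal G=\{\pm\iota^{\epsilon_1}\eta^{\alpha_1}M^{\alpha_2}\iota^{\epsilon_2}\;:\;0\le\epsilon_1,\epsilon_2,\alpha_2\le1,\ 0\le\alpha_1\le5\}.$$ -/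

import Mathlib

open Filter Topology Matrix

noncomputable section

namespace Holonomy

/-- `GL₄(ℚ)`, with the four indices grouped in two blocks of size two. The index order is
`inl 0, inl 1, inr 0, inr 1`, matching the coordinates `u₁, v₁, u₂, v₂` of `ℂ⁴`. -/
abbrev GL4 : Type := GL (Fin 2 ⊕ Fin 2) ℚ

/-- The four `2 × 2` blocks of `M = (A₁ A₂; A₃ A₄)`. -/
def A₁ (M : GL4) : Matrix (Fin 2) (Fin 2) ℚ := M.val.toBlocks₁₁
def A₂ (M : GL4) : Matrix (Fin 2) (Fin 2) ℚ := M.val.toBlocks₁₂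
def A₃ (M : GL4) : Matrix (Fin 2) (Fin 2) ℚ := M.val.toBlocks₂₁
def A₄ (M : GL4) : Matrix (Fin 2) (Fin 2) ℚ := M.val.toBlocks₂₂

def IsTypeI (M : GL4) : Prop :=
  (A₁ M).det = 1 ∧ (A₄ M).det = 1 ∧ A₂ M = 0 ∧ A₃ M = 0

def IsTypeII (M : GL4) : Prop :=
  (A₃ M).det = 1 ∧ (A₂ M).det = 1 ∧ A₁ M = 0 ∧ A₄ M = 0

def IsTypeIII (M : GL4) : Prop :=
  ((A₁ M).det ≠ 0 ∧ (A₂ M).det ≠ 0 ∧ (A₃ M).det ≠ 0 ∧ (A₄ M).det ≠ 0) ∧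
  (A₁ M).det = (A₄ M).det ∧ (A₂ M).det = (A₃ M).det ∧ (A₁ M).det + (A₃ M).det = 1 ∧
  (A₁ M).det • ((A₁ M)⁻¹ * A₂ M) = -((A₃ M).det • ((A₃ M)⁻¹ * A₄ M))

/-- The minimal polynomial of `M` over `ℚ`. -/
def minPoly (M : GL4) : Polynomial ℚ := minpoly ℚ M.val

/-- `ι = I ⊕ (-I)`. -/
def iota : GL4 where
  val := Matrix.fromBlocks 1 0 0 (-1)
  inv := Matrix.fromBlocks 1 0 0 (-1)
  val_inv := by simp [Matrix.fromBlocks_multiply]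
  inv_val := by simp [Matrix.fromBlocks_multiply]

/-- The data of a (germ at the origin of a) surface in `ℂ⁴` given by `v₁, v₂` as functions of
`u = (u₁, u₂)`, with linear coefficients `τ₁, τ₂`. The indices `1, 2` are written `0, 1`.
Only the values of `v` near `0` matter below. -/
structure SurfaceData where
  τ : Fin 2 → ℂ
  v : Fin 2 → (Fin 2 → ℂ) → ℂ

namespace SurfaceData

variable (X : SurfaceData)

/-- The subset `{v₁ = v₁(u₁, u₂), v₂ = v₂(u₁, u₂)}` of `ℂ⁴` with coordinates
`(u₁, v₁, u₂, v₂)`. -/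
def carrier : Set (Fin 2 ⊕ Fin 2 → ℂ) :=
  {x | x (Sum.inl 1) = X.v 0 ![x (Sum.inl 0), x (Sum.inr 0)] ∧
       x (Sum.inr 1) = X.v 1 ![x (Sum.inl 0), x (Sum.inr 0)]}

/-- The linear action of a rational matrix on `ℂ⁴`. -/
def act (M : GL4) (x : Fin 2 ⊕ Fin 2 → ℂ) : Fin 2 ⊕ Fin 2 → ℂ :=
  (M.val.map (fun q : ℚ => (q : ℂ))) *ᵥ x

theorem act_one (x : Fin 2 ⊕ Fin 2 → ℂ) : act 1 x = x := by
  simp [act, Matrix.map_one]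

theorem act_mul (M N : GL4) (x : Fin 2 ⊕ Fin 2 → ℂ) : act (M * N) x = act M (act N x) := by
  have h : (M.val * N.val).map (fun q : ℚ => (q : ℂ)) =
      M.val.map (fun q : ℚ => (q : ℂ)) * N.val.map (fun q : ℚ => (q : ℂ)) :=
    Matrix.map_mul (f := Rat.castHom ℂ)
  simp only [act, Units.val_mul, h, Matrix.mulVec_mulVec]

theorem tendsto_act (M : GL4) : Tendsto (act M) (𝓝 0) (𝓝 0) := by
  have h : Continuous (act M) := by unfold act; fun_prop
  simpa [act] using h.tendsto 0

/-- `Aut 𝒳 ∩ GL₄(ℚ)`: the invertible rational matrices preserving the germ of the surface at the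
origin. -/
def Aut : Subgroup GL4 where
  carrier := {M | ∀ᶠ x in 𝓝 (0 : Fin 2 ⊕ Fin 2 → ℂ), act M x ∈ X.carrier ↔ x ∈ X.carrier}
  one_mem' := by simp [act_one]
  mul_mem' := by
    intro M N hM hN
    filter_upwards [(tendsto_act N).eventually hM, hN] with x h1 h2
    rw [act_mul, h1, h2]
  inv_mem' := by
    intro M hM
    filter_upwards [(tendsto_act M⁻¹).eventually hM] with x h
    rw [← h, ← act_mul, mul_inv_cancel, act_one]

/-- The generalized analytic holonomy sets. -/
structure IsGhol : Prop where
  /-- the `vᵢ` are holomorphic near the origin -/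
  analytic : ∀ i, AnalyticAt ℂ (X.v i) 0
  /-- `vᵢ = τᵢ uᵢ +` a convergent series of monomials of odd total degree at least `3` -/
  expansion : ∀ i, ∃ c : ℕ × ℕ → ℂ,
    (∀ p : ℕ × ℕ, c p ≠ 0 → 3 ≤ p.1 + p.2 ∧ Odd (p.1 + p.2)) ∧
    ∀ᶠ u in 𝓝 (0 : Fin 2 → ℂ),
      HasSum (fun p : ℕ × ℕ => c p * u 0 ^ p.1 * u 1 ^ p.2) (X.v i u - X.τ i * u i)
  im_pos : ∀ i, 0 < (X.τ i).im
  nonlinear₁ : ¬ ∀ᶠ t in 𝓝 (0 : ℂ), X.v 0 ![t, 0] = X.τ 0 * t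
  nonlinear₂ : ¬ ∀ᶠ t in 𝓝 (0 : ℂ), X.v 1 ![0, t] = X.τ 1 * t
  v₁_even : ∀ᶠ u in 𝓝 (0 : Fin 2 → ℂ), X.v 0 u = X.v 0 ![u 0, -u 1]
  v₁_odd : ∀ᶠ u in 𝓝 (0 : Fin 2 → ℂ), X.v 0 u = -X.v 0 ![-u 0, u 1]
  v₂_even : ∀ᶠ u in 𝓝 (0 : Fin 2 → ℂ), X.v 1 u = X.v 1 ![-u 0, u 1]
  v₂_odd : ∀ᶠ u in 𝓝 (0 : Fin 2 → ℂ), X.v 1 u = -X.v 1 ![u 0, -u 1]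
  /-- `∂v₁/∂u₂ = a ∂v₂/∂u₁` for a constant `a` -/
  symmetric : ∃ a : ℂ, ∀ᶠ u in 𝓝 (0 : Fin 2 → ℂ),
    deriv (fun t => X.v 0 ![u 0, t]) (u 1) = a * deriv (fun s => X.v 1 ![s, u 1]) (u 0)
  finite_subgroups : ∀ H : Subgroup GL4, H ≤ X.Aut → (H : Set GL4).Finite

/-- The field `ℚ(√-3)` inside `ℂ`. -/
def QSqrtNegThree : IntermediateField ℚ ℂ :=
  IntermediateField.adjoin ℚ {(Real.sqrt 3 : ℂ) * Complex.I}

/-- The subgroup of `Aut 𝒳` generated by its elements of Types I, II and III. -/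
def typeGroup : Subgroup GL4 :=
  Subgroup.closure {N | N ∈ X.Aut ∧ (IsTypeI N ∨ IsTypeII N ∨ IsTypeIII N)}

end SurfaceData

/-- `η = (ι M⁵)(ι M²)`. -/
def eta (M : GL4) : GL4 := (iota * M ^ 5) * (iota * M ^ 2)

end Holonomy

end

open Holonomy Polynomial

/-!
The proof reduces the theorem to a finite group of `2 × 2` complex matrices.

Differentiating at the origin, an automorphism of the germ preserves the tangent plane
`{v₁ = τ₁ u₁, v₂ = τ₂ u₂}` (`IsGhol.act_tangent`). A rational matrix preserving this plane is
determined by its action there (`tangentMap_injective`), because `1, τᵢ` are linearly independent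
over `ℚ`. Types I, II and III are exactly the ways in which a matrix preserving the plane can be
symplectic for the form `du₁ ∧ dv₁ + du₂ ∧ dv₂`, so `typeGroup` is the group of symplectic
automorphisms (`IsGhol.typeGroup_eq`). On the tangent plane this form induces the Hermitian form
`Im τ₁ |u₁|² + Im τ₂ |u₂|²`. Hence `typeGroup` has a faithful two-dimensional unitary
representation whose traces lie in `ℚ(√-3)` and which keeps minimal polynomials over `ℚ`
(`PlaneRep`); moreover the group is finite.

The minimal polynomial of `M` says that `M` acts as `diag(s, s z)` in some unitary basis, with
`s = ±1` and `z` a primitive sixth root of unity. As `1 - z` is a unit, the diagonal entries of any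
element `g` are integers of `ℚ(√-3)`, obtained from the traces of `g` and `g M`; being in the unit
disc they vanish or are sixth roots of unity (`diagonal_entries`). So every element is diagonal or
antidiagonal. Since `ι` does not commute with `M`, it is antidiagonal, and after rescaling it is
the interchange of the two basis vectors (`NormalForm`). The group is therefore the full group of
monomial `2 × 2` matrices with sixth roots of unity as entries, of order 72, and `η` acts as
`s diag(z⁵, z²)`. The list of words is a computation with exponents modulo six
(`NormalForm.exists_word`). An element is of type III precisely when it neither commutes nor
anticommutes with `ι`, and its minimal polynomial over `ℚ` is read off from its eigenvalues and
their conjugates (`minpoly_eq_of_roots`).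
-/

open Holonomy Polynomial

namespace Holonomy

/-! ### The germ and its tangent plane -/

namespace SurfaceData

/-- The expansion of `vᵢ` in monomials of degree at least three makes `vᵢ - τᵢ uᵢ` a cubically
small function, so `τᵢ uᵢ` is the linear part of `vᵢ` at the origin. -/
theorem IsGhol.hasFDerivAt {S : SurfaceData} (hS : S.IsGhol) (i : Fin 2) :
    HasFDerivAt (S.v i) (S.τ i • (ContinuousLinearMap.proj i : (Fin 2 → ℂ) →L[ℂ] ℂ)) 0 := by
  obtain ⟨c, hc, hsum⟩ := hS.expansion i
  obtain ⟨r, hr, hball⟩ := Metric.eventually_nhds_iff.1 hsum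
  have hr2 : (0 : ℝ) < r / 2 := by positivity
  -- absolute convergence at one point off the axes dominates the series near the origin
  have hdom : Summable fun p : ℕ × ℕ => ‖c p‖ * (r / 2) ^ (p.1 + p.2) := by
    have h := (hball (y := fun _ => ((r / 2 : ℝ) : ℂ)) (by
      rw [dist_pi_lt_iff hr]
      intro b
      simp only [Pi.zero_apply, dist_zero_right, Complex.norm_real, Real.norm_eq_abs,
        abs_of_pos hr2]
      linarith)).summable.norm
    refine h.congr fun p => ?_
    simp only [norm_mul, norm_pow, Complex.norm_real, Real.norm_eq_abs, abs_of_pos hr2, pow_add,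
      mul_assoc]
  set C := ∑' p : ℕ × ℕ, ‖c p‖ * (r / 2) ^ (p.1 + p.2) with hC
  have hbound : ∀ u : Fin 2 → ℂ, ‖u‖ ≤ r / 2 →
      ‖S.v i u - S.τ i * u i‖ ≤ C * (‖u‖ / (r / 2)) ^ 3 := by
    intro u hu
    have hS' := hball (y := u) (by rw [dist_zero_right]; linarith)
    have hq1 : ‖u‖ / (r / 2) ≤ 1 := (div_le_one hr2).2 hu
    have hq0 : 0 ≤ ‖u‖ / (r / 2) := by positivity
    refine hS'.norm_le_of_bounded (hdom.hasSum.mul_right _) fun p => ?_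
    by_cases hp : c p = 0
    · simp [hp]
    have h3 := (hc p hp).1
    have hu' : ‖u‖ = r / 2 * (‖u‖ / (r / 2)) := by field_simp
    calc ‖c p * u 0 ^ p.1 * u 1 ^ p.2‖ = ‖c p‖ * (‖u 0‖ ^ p.1 * ‖u 1‖ ^ p.2) := by
          simp [mul_assoc]
      _ ≤ ‖c p‖ * (‖u‖ ^ p.1 * ‖u‖ ^ p.2) := by
          gcongr <;> exact norm_le_pi_norm u _
      _ = ‖c p‖ * (r / 2) ^ (p.1 + p.2) * (‖u‖ / (r / 2)) ^ (p.1 + p.2) := by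
          rw [← pow_add, mul_assoc, ← mul_pow, ← hu']
      _ ≤ ‖c p‖ * (r / 2) ^ (p.1 + p.2) * (‖u‖ / (r / 2)) ^ 3 :=
          mul_le_mul_of_nonneg_left (pow_le_pow_of_le_one hq0 hq1 h3) (by positivity)
  have h0 : S.v i 0 = 0 := by
    have := hbound 0 (by simpa using hr2.le)
    simpa using this
  rw [hasFDerivAt_iff_isLittleO_nhds_zero]
  have hO : (fun u : Fin 2 → ℂ => S.v i u - S.τ i * u i) =O[𝓝 0] fun u => ‖u‖ ^ 3 := by
    refine Asymptotics.IsBigO.of_bound (C / (r / 2) ^ 3) ?_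
    filter_upwards [Metric.closedBall_mem_nhds (0 : Fin 2 → ℂ) hr2] with u hu
    refine (hbound u (by simpa using hu)).trans_eq ?_
    rw [norm_pow, norm_norm, div_pow]
    ring
  have ho : (fun u : Fin 2 → ℂ => ‖u‖ ^ 3) =o[𝓝 0] fun u => u :=
    Asymptotics.isLittleO_norm_pow_id (by norm_num)
  refine (hO.trans_isLittleO ho).congr_left fun u => ?_
  simp [h0]

theorem IsGhol.v_zero {S : SurfaceData} (hS : S.IsGhol) (i : Fin 2) : S.v i 0 = 0 := by
  obtain ⟨c, hc, hsum⟩ := hS.expansion i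
  have h := hsum.self_of_nhds
  have h' : HasSum (fun p : ℕ × ℕ => c p * (0 : Fin 2 → ℂ) 0 ^ p.1 * (0 : Fin 2 → ℂ) 1 ^ p.2) 0 := by
    convert hasSum_zero with p
    by_cases hp : c p = 0
    · simp [hp]
    have h3 := (hc p hp).1
    rcases Nat.eq_zero_or_pos p.1 with h1 | h1
    · have : p.2 ≠ 0 := by omega
      simp [this]
    · simp [h1.ne']
  simpa using h.unique h'

/-- The symmetry `(u₁, v₁, u₂, v₂) ↦ (u₁, v₁, -u₂, -v₂)`. -/
theorem IsGhol.iota_mem {S : SurfaceData} (hS : S.IsGhol) : iota ∈ S.Aut := by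
  have hc : Tendsto (fun x : Fin 2 ⊕ Fin 2 → ℂ => ![x (Sum.inl 0), x (Sum.inr 0)]) (𝓝 0) (𝓝 0) := by
    have h : Continuous (fun x : Fin 2 ⊕ Fin 2 → ℂ => ![x (Sum.inl 0), x (Sum.inr 0)]) := by
      fun_prop
    have h0 : ![(0 : ℂ), 0] = 0 := by ext i; fin_cases i <;> rfl
    simpa [h0] using h.tendsto 0
  show ∀ᶠ x in 𝓝 (0 : Fin 2 ⊕ Fin 2 → ℂ), act iota x ∈ S.carrier ↔ x ∈ S.carrier
  filter_upwards [hc.eventually hS.v₁_even, hc.eventually hS.v₂_odd] with x h1 h2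
  have e : act iota x = Sum.elim ![x (Sum.inl 0), x (Sum.inl 1)] ![-x (Sum.inr 0), -x (Sum.inr 1)] := by
    ext (i | i) <;> fin_cases i <;> simp [act, iota, Matrix.mulVec, dotProduct]
  simp only [Matrix.cons_val_zero, Matrix.cons_val_one] at h1 h2
  simp [carrier, e, h1, h2, neg_eq_iff_eq_neg]

/-- The symmetry `(u₁, v₁, u₂, v₂) ↦ (-u₁, -v₁, u₂, v₂)`. -/
theorem IsGhol.neg_iota_mem {S : SurfaceData} (hS : S.IsGhol) : -iota ∈ S.Aut := by
  have hc : Tendsto (fun x : Fin 2 ⊕ Fin 2 → ℂ => ![x (Sum.inl 0), x (Sum.inr 0)]) (𝓝 0) (𝓝 0) := by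
    have h : Continuous (fun x : Fin 2 ⊕ Fin 2 → ℂ => ![x (Sum.inl 0), x (Sum.inr 0)]) := by
      fun_prop
    have h0 : ![(0 : ℂ), 0] = 0 := by ext i; fin_cases i <;> rfl
    simpa [h0] using h.tendsto 0
  show ∀ᶠ x in 𝓝 (0 : Fin 2 ⊕ Fin 2 → ℂ), act (-iota) x ∈ S.carrier ↔ x ∈ S.carrier
  filter_upwards [hc.eventually hS.v₁_odd, hc.eventually hS.v₂_even] with x h1 h2
  have e : act (-iota) x =
      Sum.elim ![-x (Sum.inl 0), -x (Sum.inl 1)] ![x (Sum.inr 0), x (Sum.inr 1)] := by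
    ext (i | i) <;> fin_cases i <;> simp [act, iota, Matrix.mulVec, dotProduct]
  simp only [Matrix.cons_val_zero, Matrix.cons_val_one] at h1 h2
  simp [carrier, e, h1, h2, neg_eq_iff_eq_neg]

/-- An automorphism maps the tangent plane `{v₁ = τ₁ u₁, v₂ = τ₂ u₂}` of the surface at the origin
into itself. -/
theorem IsGhol.act_tangent {S : SurfaceData} (hS : S.IsGhol) {N : GL4} (hN : N ∈ S.Aut)
    (w : Fin 2 → ℂ) :
    let y := act N (Sum.elim ![w 0, S.τ 0 * w 0] ![w 1, S.τ 1 * w 1])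
    y (Sum.inl 1) = S.τ 0 * y (Sum.inl 0) ∧ y (Sum.inr 1) = S.τ 1 * y (Sum.inr 0) := by
  intro y
  let γ : ℂ → Fin 2 ⊕ Fin 2 → ℂ := fun t =>
    Sum.elim ![t * w 0, S.v 0 (t • w)] ![t * w 1, S.v 1 (t • w)]
  have hline : HasDerivAt (fun t : ℂ => t • w) w 0 := by
    simpa using (hasDerivAt_id (0 : ℂ)).smul_const w
  have hv : ∀ i, HasDerivAt (fun t : ℂ => S.v i (t • w)) (S.τ i * w i) 0 := fun i => by
    have h := HasFDerivAt.comp_hasDerivAt (x := (0 : ℂ)) (f := fun t : ℂ => t • w)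
      (by simpa using hS.hasFDerivAt i) hline
    simpa [Function.comp_def] using h
  have hlin : ∀ i, HasDerivAt (fun t : ℂ => t * w i) (w i) 0 := fun i => by
    simpa using (hasDerivAt_id (0 : ℂ)).mul_const (w i)
  have hγ : HasDerivAt γ (Sum.elim ![w 0, S.τ 0 * w 0] ![w 1, S.τ 1 * w 1]) 0 := by
    rw [hasDerivAt_pi]
    rintro (i | i) <;> fin_cases i
    · exact hlin 0
    · exact hv 0
    · exact hlin 1
    · exact hv 1
  have hNγ : HasDerivAt (fun t => act N (γ t)) y 0 := by
    have h := ((Matrix.mulVecLin (N.val.map (fun q : ℚ => (q : ℂ)))).toContinuousLinearMap).hasFDerivAt.comp_hasDerivAt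
      (0 : ℂ) hγ
    exact h
  have hcomp := hasDerivAt_pi.1 hNγ
  have hγ0 : γ 0 = 0 := by
    ext (i | i) <;> fin_cases i <;> simp [γ, hS.v_zero]
  have hmem : ∀ᶠ t in 𝓝 (0 : ℂ), act N (γ t) ∈ S.carrier := by
    have h : Tendsto γ (𝓝 0) (𝓝 0) := by simpa [hγ0] using hγ.continuousAt.tendsto
    filter_upwards [h.eventually hN] with t ht
    refine ht.2 ⟨?_, ?_⟩
    · show S.v 0 (t • w) = S.v 0 ![t * w 0, t * w 1]
      congr 1; ext i; fin_cases i <;> rfl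
    · show S.v 1 (t • w) = S.v 1 ![t * w 0, t * w 1]
      congr 1; ext i; fin_cases i <;> rfl
  have hu : HasDerivAt (fun t => ![act N (γ t) (Sum.inl 0), act N (γ t) (Sum.inr 0)])
      ![y (Sum.inl 0), y (Sum.inr 0)] 0 := by
    rw [hasDerivAt_pi]
    intro i; fin_cases i
    · exact hcomp (Sum.inl 0)
    · exact hcomp (Sum.inr 0)
  have hu0 : ![act N (γ 0) (Sum.inl 0), act N (γ 0) (Sum.inr 0)] = 0 := by
    rw [hγ0]; ext i; fin_cases i <;> simp [act]
  have hvu : ∀ i, HasDerivAt (fun t => S.v i ![act N (γ t) (Sum.inl 0), act N (γ t) (Sum.inr 0)])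
      (S.τ i * ![y (Sum.inl 0), y (Sum.inr 0)] i) 0 := fun i => by
    have h := HasFDerivAt.comp_hasDerivAt (x := (0 : ℂ)) (by rw [hu0]; exact hS.hasFDerivAt i) hu
    simpa [Function.comp_def] using h
  exact ⟨(hcomp (Sum.inl 1)).unique ((hvu 0).congr_of_eventuallyEq (hmem.mono fun t ht => ht.1)),
    (hcomp (Sum.inr 1)).unique ((hvu 1).congr_of_eventuallyEq (hmem.mono fun t ht => ht.2))⟩

end SurfaceData

/-! ### Symplectic matrices and the three types -/

/-- The standard symplectic matrix of size two. -/
def J₂ : Matrix (Fin 2) (Fin 2) ℚ := !![0, 1; -1, 0]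

/-- The symplectic form `J₂ ⊕ J₂` on `ℚ⁴`. -/
def Ω : Matrix (Fin 2 ⊕ Fin 2) (Fin 2 ⊕ Fin 2) ℚ := fromBlocks J₂ 0 0 J₂

/-- The isometries of the symplectic form `Ω`, as a subgroup of `GL₄(ℚ)`. -/
def symplectic : Subgroup GL4 where
  carrier := {N | N.valᵀ * Ω * N.val = Ω}
  one_mem' := by simp
  mul_mem' := by
    intro A B hA hB
    simp only [Set.mem_ofPred_eq, Units.val_mul, transpose_mul] at *
    calc B.valᵀ * A.valᵀ * Ω * (A.val * B.val) = B.valᵀ * (A.valᵀ * Ω * A.val) * B.val := by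
          simp only [Matrix.mul_assoc]
      _ = Ω := by rw [hA, hB]
  inv_mem' := by
    intro A hA
    simp only [Set.mem_ofPred_eq] at *
    have h : A.val * (A⁻¹).val = 1 := by rw [← Units.val_mul]; simp
    calc (A⁻¹).valᵀ * Ω * (A⁻¹).val = (A⁻¹).valᵀ * (A.valᵀ * Ω * A.val) * (A⁻¹).val := by rw [hA]
      _ = (A.val * (A⁻¹).val)ᵀ * Ω * (A.val * (A⁻¹).val) := by
          simp only [Matrix.mul_assoc, transpose_mul]
      _ = Ω := by rw [h]; simp

theorem mem_symplectic {N : GL4} : N ∈ symplectic ↔ N.valᵀ * Ω * N.val = Ω := Iff.rfl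

theorem val_eq_fromBlocks (N : GL4) : N.val = fromBlocks (A₁ N) (A₂ N) (A₃ N) (A₄ N) :=
  (fromBlocks_toBlocks N.val).symm

theorem transpose_mul_J₂_mul (A : Matrix (Fin 2) (Fin 2) ℚ) : Aᵀ * J₂ * A = A.det • J₂ := by
  ext i j
  fin_cases i <;> fin_cases j <;>
    simp [J₂, Matrix.mul_apply, Fin.sum_univ_two, det_fin_two] <;> ring

theorem mul_J₂_mul_transpose (A : Matrix (Fin 2) (Fin 2) ℚ) : A * J₂ * Aᵀ = A.det • J₂ := by
  simpa using transpose_mul_J₂_mul Aᵀ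

theorem transpose_mul_J₂ (A : Matrix (Fin 2) (Fin 2) ℚ) : Aᵀ * J₂ = J₂ * A.adjugate := by
  ext i j
  fin_cases i <;> fin_cases j <;>
    simp [J₂, Matrix.mul_apply, Fin.sum_univ_two, adjugate_fin_two]

theorem smul_J₂_injective {x y : ℚ} (h : x • J₂ = y • J₂) : x = y := by
  simpa [J₂] using congrFun (congrFun h 0) 1

theorem J₂_mul_J₂ : J₂ * J₂ = -1 := by
  ext i j; fin_cases i <;> fin_cases j <;> simp [J₂]

theorem J₂_mul_cancel {A B : Matrix (Fin 2) (Fin 2) ℚ} (h : J₂ * A = J₂ * B) : A = B := by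
  have := congrArg (J₂ * ·) h
  simpa [← Matrix.mul_assoc, J₂_mul_J₂] using this

theorem det_smul_inv {A : Matrix (Fin 2) (Fin 2) ℚ} (h : A.det ≠ 0) :
    A.det • A⁻¹ = A.adjugate := by
  rw [Matrix.inv_def, smul_smul, Ring.inverse_eq_inv', mul_inv_cancel₀ h, one_smul]

/-- The symplectic condition in terms of blocks. -/
theorem mem_symplectic_iff {N : GL4} : N ∈ symplectic ↔
    (A₁ N).det + (A₃ N).det = 1 ∧ (A₂ N).det + (A₄ N).det = 1 ∧
      (A₁ N).adjugate * A₂ N = -((A₃ N).adjugate * A₄ N) := by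
  have e : N.valᵀ * Ω * N.val = fromBlocks
      (((A₁ N).det + (A₃ N).det) • J₂)
      (J₂ * ((A₁ N).adjugate * A₂ N + (A₃ N).adjugate * A₄ N))
      ((A₂ N)ᵀ * J₂ * A₁ N + (A₄ N)ᵀ * J₂ * A₃ N)
      (((A₂ N).det + (A₄ N).det) • J₂) := by
    rw [val_eq_fromBlocks, Ω]
    simp only [fromBlocks_transpose, fromBlocks_multiply, Matrix.mul_zero, add_zero, zero_add,
      transpose_mul_J₂_mul, add_smul, Matrix.mul_add, ← Matrix.mul_assoc, transpose_mul_J₂ (A₁ N),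
      transpose_mul_J₂ (A₃ N)]
    simp only [← transpose_mul_J₂, transpose_mul_J₂_mul]
  rw [mem_symplectic, e, Ω, fromBlocks_inj]
  constructor
  · rintro ⟨h1, h2, -, h4⟩
    refine ⟨smul_J₂_injective (by simpa using h1), smul_J₂_injective (by simpa using h4), ?_⟩
    rw [eq_neg_iff_add_eq_zero]
    exact J₂_mul_cancel (by simpa using h2)
  · rintro ⟨h1, h2, h3⟩
    have h5 : (A₂ N)ᵀ * J₂ * A₁ N + (A₄ N)ᵀ * J₂ * A₃ N =
        -(J₂ * ((A₁ N).adjugate * A₂ N + (A₃ N).adjugate * A₄ N))ᵀ := by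
      have hJ : J₂ᵀ = -J₂ := by ext i j; fin_cases i <;> fin_cases j <;> simp [J₂]
      rw [Matrix.mul_add, ← Matrix.mul_assoc, ← Matrix.mul_assoc, ← transpose_mul_J₂,
        ← transpose_mul_J₂]
      simp [transpose_mul, hJ, Matrix.mul_assoc, add_comm]
    rw [h5, h1, h2, h3]
    simp

theorem IsTypeI.mem_symplectic {N : GL4} (h : IsTypeI N) : N ∈ symplectic := by
  obtain ⟨h1, h4, h2, h3⟩ := h
  rw [mem_symplectic_iff, h1, h4, h2, h3]
  simp

theorem IsTypeII.mem_symplectic {N : GL4} (h : IsTypeII N) : N ∈ symplectic := by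
  obtain ⟨h3, h2, h1, h4⟩ := h
  rw [mem_symplectic_iff, h3, h2, h1, h4]
  simp

theorem IsTypeIII.mem_symplectic {N : GL4} (h : IsTypeIII N) : N ∈ symplectic := by
  obtain ⟨⟨h1, h2, h3, h4⟩, h14, h23, h13, h⟩ := h
  rw [← smul_mul_assoc, ← smul_mul_assoc, det_smul_inv h1, det_smul_inv h3] at h
  exact mem_symplectic_iff.2 ⟨h13, by linarith, h⟩

/-- The transpose of a symplectic matrix is symplectic; on the diagonal blocks this gives two
further relations between determinants. -/
theorem det_add_det_of_mem_symplectic {N : GL4} (h : N ∈ symplectic) :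
    (A₁ N).det + (A₂ N).det = 1 ∧ (A₃ N).det + (A₄ N).det = 1 := by
  have hΩ : Ω * Ω = -1 := by
    simp [Ω, fromBlocks_multiply, J₂_mul_J₂, ← fromBlocks_one, fromBlocks_neg]
  rw [Holonomy.mem_symplectic] at h
  have h1 : (-Ω * N.valᵀ * Ω) * N.val = 1 := by
    rw [Matrix.mul_assoc, Matrix.mul_assoc, ← Matrix.mul_assoc N.valᵀ, h]
    simp [hΩ]
  have h2 : N.val * Ω * N.valᵀ = Ω := by
    have h3 := congrArg (· * Ω) (mul_eq_one_comm.1 h1)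
    simp only [Matrix.mul_assoc, hΩ, one_mul, Matrix.mul_neg, Matrix.neg_mul, mul_one, neg_neg] at h3
    rw [Matrix.mul_assoc, h3]
  rw [val_eq_fromBlocks, Ω] at h2
  simp only [fromBlocks_transpose, fromBlocks_multiply, Matrix.mul_zero, add_zero, zero_add,
    mul_J₂_mul_transpose, fromBlocks_inj, ← add_smul] at h2
  exact ⟨smul_J₂_injective (by simpa using h2.1), smul_J₂_injective (by simpa using h2.2.2.2)⟩

theorem IsTypeI.iota_mul {N : GL4} (h : IsTypeI N) : iota * N = N * iota := by
  apply Units.ext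
  rw [Units.val_mul, Units.val_mul, val_eq_fromBlocks N, h.2.2.1, h.2.2.2]
  simp [iota, fromBlocks_multiply]

theorem IsTypeII.iota_mul {N : GL4} (h : IsTypeII N) : iota * N = -(N * iota) := by
  apply Units.ext
  rw [Units.val_neg, Units.val_mul, Units.val_mul, val_eq_fromBlocks N, h.2.2.1, h.2.2.2]
  simp [iota, fromBlocks_multiply, fromBlocks_neg]

theorem A₂_eq_zero_of_iota_mul {N : GL4} (h : iota * N = N * iota) : A₂ N = 0 := by
  have h' := congrArg Units.val h
  rw [Units.val_mul, Units.val_mul, val_eq_fromBlocks N] at h'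
  simp only [iota, fromBlocks_multiply, fromBlocks_inj] at h'
  have h2 := h'.2.1
  simp only [Matrix.one_mul, Matrix.zero_mul, add_zero, Matrix.mul_zero, zero_add, Matrix.mul_neg,
    Matrix.mul_one] at h2
  ext i j
  have := congrFun (congrFun h2 i) j
  simp only [Matrix.neg_apply, Matrix.zero_apply] at this ⊢
  linarith

theorem isTypeI_iota : IsTypeI iota := by
  refine ⟨?_, ?_, ?_, ?_⟩ <;> simp [iota, A₁, A₂, A₃, A₄, det_fin_two]

theorem isTypeI_neg_iota : IsTypeI (-iota) := by
  refine ⟨?_, ?_, ?_, ?_⟩ <;> simp [iota, A₁, A₂, A₃, A₄, det_fin_two, fromBlocks_neg]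

/-- A type III matrix is distinguished from types I and II by its commutation with `ι`. -/
theorem isTypeIII_of_iota_mul_ne {N : GL4} (h : IsTypeI N ∨ IsTypeII N ∨ IsTypeIII N)
    (h1 : iota * N ≠ N * iota) (h2 : iota * N ≠ -(N * iota)) : IsTypeIII N := by
  rcases h with h | h | h
  exacts [absurd h.iota_mul h1, absurd h.iota_mul h2, h]

theorem isTypeI_of_iota_mul_eq {N : GL4} (h : IsTypeI N ∨ IsTypeII N ∨ IsTypeIII N)
    (h1 : iota * N = N * iota) : IsTypeI N := by
  have h2 := A₂_eq_zero_of_iota_mul h1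
  rcases h with h | h | h
  · exact h
  · exact absurd h.2.1 (by simp [h2])
  · exact absurd h2 (fun h0 => h.1.2.1 (by simp [h0]))

/-! ### The action on the tangent plane -/

/-- A rational `4 × 4` matrix regarded as a complex one. -/
noncomputable def toComplex :
    Matrix (Fin 2 ⊕ Fin 2) (Fin 2 ⊕ Fin 2) ℚ →ₐ[ℚ] Matrix (Fin 2 ⊕ Fin 2) (Fin 2 ⊕ Fin 2) ℂ :=
  (Algebra.ofId ℚ ℂ).mapMatrix

@[simp] theorem toComplex_apply (A : Matrix (Fin 2 ⊕ Fin 2) (Fin 2 ⊕ Fin 2) ℚ) (i j) :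
    toComplex A i j = (A i j : ℂ) := rfl

/-- The basis of the plane `{v₁ = τ₁ u₁, v₂ = τ₂ u₂}` parametrised by `(u₁, u₂)`, as columns. -/
def tangentBasis (τ : Fin 2 → ℂ) : Matrix (Fin 2 ⊕ Fin 2) (Fin 2) ℂ :=
  fromRows !![1, 0; τ 0, 0] !![0, 1; 0, τ 1]

/-- The projection of `ℂ⁴` to the coordinates `(u₁, u₂)`. -/
def coordProj : Matrix (Fin 2) (Fin 2 ⊕ Fin 2) ℂ :=
  fromCols !![1, 0; 0, 0] !![0, 0; 1, 0]

theorem coordProj_mul_tangentBasis (τ : Fin 2 → ℂ) : coordProj * tangentBasis τ = 1 := by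
  rw [coordProj, tangentBasis, fromCols_mul_fromRows]
  ext i j; fin_cases i <;> fin_cases j <;> simp

/-- The rational matrices mapping the plane `{v₁ = τ₁ u₁, v₂ = τ₂ u₂}` into itself. -/
noncomputable def tangentAlgebra (τ : Fin 2 → ℂ) :
    Subalgebra ℚ (Matrix (Fin 2 ⊕ Fin 2) (Fin 2 ⊕ Fin 2) ℚ) where
  carrier := {A | toComplex A * tangentBasis τ =
    tangentBasis τ * (coordProj * toComplex A * tangentBasis τ)}
  mul_mem' := by
    intro A B hA hB
    simp only [Set.mem_ofPred_eq, map_mul] at *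
    set P := tangentBasis τ
    calc toComplex A * toComplex B * P = toComplex A * (toComplex B * P) := Matrix.mul_assoc ..
      _ = toComplex A * P * (coordProj * toComplex B * P) := by
          rw [hB, ← Matrix.mul_assoc]
      _ = P * (coordProj * (toComplex A * P) * (coordProj * toComplex B * P)) := by
          rw [hA]
          simp only [← Matrix.mul_assoc]
          rw [Matrix.mul_assoc P coordProj P, coordProj_mul_tangentBasis, Matrix.mul_one]
      _ = P * (coordProj * toComplex A * (P * (coordProj * toComplex B * P))) := by
          simp only [Matrix.mul_assoc]
      _ = P * (coordProj * (toComplex A * toComplex B) * P) := by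
          rw [← hB]; simp only [Matrix.mul_assoc]
  add_mem' := by
    intro A B hA hB
    simp only [Set.mem_ofPred_eq, map_add, Matrix.add_mul, Matrix.mul_add] at *
    rw [← hA, ← hB]
  algebraMap_mem' := by
    intro r
    simp only [Set.mem_ofPred_eq, Algebra.algebraMap_eq_smul_one, map_smul, map_one,
      Matrix.smul_mul, Matrix.mul_smul, Matrix.mul_one, Matrix.one_mul,
      coordProj_mul_tangentBasis]

theorem mem_tangentAlgebra {τ : Fin 2 → ℂ} {A : Matrix (Fin 2 ⊕ Fin 2) (Fin 2 ⊕ Fin 2) ℚ} :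
    A ∈ tangentAlgebra τ ↔ toComplex A * tangentBasis τ =
      tangentBasis τ * (coordProj * toComplex A * tangentBasis τ) := Iff.rfl

/-- The action of a matrix on the plane `{v₁ = τ₁ u₁, v₂ = τ₂ u₂}`, in the coordinates
`(u₁, u₂)`. -/
noncomputable def tangentMap (τ : Fin 2 → ℂ) :
    tangentAlgebra τ →ₐ[ℚ] Matrix (Fin 2) (Fin 2) ℂ :=
  AlgHom.ofLinearMap
    { toFun := fun A => coordProj * toComplex A.val * tangentBasis τ
      map_add' := by intro A B; simp [Matrix.mul_add, Matrix.add_mul]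
      map_smul' := by intro r A; simp }
    (by simp [coordProj_mul_tangentBasis])
    (by
      intro A B
      simp only [LinearMap.coe_mk, AddHom.coe_mk, MulMemClass.coe_mul, map_mul]
      have hB := mem_tangentAlgebra.1 B.2
      calc coordProj * (toComplex A.val * toComplex B.val) * tangentBasis τ
          = coordProj * toComplex A.val * (toComplex B.val * tangentBasis τ) := by
            simp only [Matrix.mul_assoc]
        _ = _ := by rw [hB]; simp only [Matrix.mul_assoc])

theorem tangentMap_apply {τ : Fin 2 → ℂ} (A : tangentAlgebra τ) :
    tangentMap τ A = coordProj * toComplex A.val * tangentBasis τ := rfl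

theorem tangentMap_entries {τ : Fin 2 → ℂ} (A : tangentAlgebra τ) (i j : Fin 2) :
    tangentMap τ A i j = if j = 0
      then A.val ((![.inl 0, .inr 0] : Fin 2 → Fin 2 ⊕ Fin 2) i) (.inl 0) +
        A.val ((![.inl 0, .inr 0] : Fin 2 → Fin 2 ⊕ Fin 2) i) (.inl 1) * τ 0
      else A.val ((![.inl 0, .inr 0] : Fin 2 → Fin 2 ⊕ Fin 2) i) (.inr 0) +
        A.val ((![.inl 0, .inr 0] : Fin 2 → Fin 2 ⊕ Fin 2) i) (.inr 1) * τ 1 := by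
  fin_cases i <;> fin_cases j <;>
    simp [tangentMap_apply, coordProj, tangentBasis, Matrix.mul_apply, Fintype.sum_sum_type]

/-- Rational independence of `1` and a non-real number. -/
theorem eq_zero_of_add_mul_eq_zero {τ : ℂ} (hτ : τ.im ≠ 0) {a b : ℚ}
    (h : (a : ℂ) + b * τ = 0) : a = 0 ∧ b = 0 := by
  have him := congrArg Complex.im h
  have hb : b = 0 := by simpa [hτ] using him
  subst hb
  exact ⟨by simpa using h, rfl⟩

theorem tangentMap_injective {τ : Fin 2 → ℂ} (hτ : ∀ i, (τ i).im ≠ 0) :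
    Function.Injective (tangentMap τ) := by
  rw [injective_iff_map_eq_zero]
  intro A hA
  have h : toComplex A.val * tangentBasis τ = 0 := by
    rw [mem_tangentAlgebra.1 A.2, ← tangentMap_apply, hA, Matrix.mul_zero]
  apply Subtype.ext
  ext i j
  have h0 := congrFun (congrFun h i) 0
  have h1 := congrFun (congrFun h i) 1
  simp only [Matrix.mul_apply, Fintype.sum_sum_type, tangentBasis, fromRows_apply_inl,
    fromRows_apply_inr, Fin.sum_univ_two, toComplex_apply] at h0 h1
  simp only [of_apply, cons_val_zero, cons_val_one, cons_val', cons_val_fin_one, mul_one, mul_zero,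
    add_zero, zero_add, Matrix.zero_apply] at h0 h1
  have h0' := eq_zero_of_add_mul_eq_zero (hτ 0) h0
  have h1' := eq_zero_of_add_mul_eq_zero (hτ 1) h1
  rcases j with j | j <;> fin_cases j
  exacts [h0'.1, h0'.2, h1'.1, h1'.2]

theorem trace_tangentMap_mem {τ : Fin 2 → ℂ} {K : IntermediateField ℚ ℂ} (hτ : ∀ i, τ i ∈ K)
    (A : tangentAlgebra τ) : (tangentMap τ A).trace ∈ K := by
  rw [trace_fin_two, tangentMap_entries, tangentMap_entries]
  have hq : ∀ q : ℚ, (q : ℂ) ∈ K := fun q => K.algebraMap_mem q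
  simp only [if_true, one_ne_zero, if_false]
  exact add_mem (add_mem (hq _) (mul_mem (hq _) (hτ _))) (add_mem (hq _) (mul_mem (hq _) (hτ _)))

/-- The change from the coordinates `uᵢ` on the tangent plane to `√(Im τᵢ) uᵢ`. -/
noncomputable def scaling (τ : Fin 2 → ℂ) (hτ : ∀ i, 0 < (τ i).im) : GL (Fin 2) ℂ :=
  GeneralLinearGroup.mkOfDetNeZero (diagonal fun i => ((√(τ i).im : ℝ) : ℂ)) (by
    rw [det_diagonal, Finset.prod_ne_zero_iff]
    intro i _
    exact_mod_cast (Real.sqrt_pos.2 (hτ i)).ne')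

theorem scaling_val (τ : Fin 2 → ℂ) (hτ : ∀ i, 0 < (τ i).im) :
    (scaling τ hτ).val = diagonal fun i => ((√(τ i).im : ℝ) : ℂ) := rfl

/-- In the scaled coordinates the symplectic form induces `2i` times the standard Hermitian form on
the tangent plane. -/
theorem tangentBasis_conjTranspose_mul (τ : Fin 2 → ℂ) (hτ : ∀ i, 0 < (τ i).im) :
    (tangentBasis τ)ᴴ * toComplex Ω * tangentBasis τ =
      (2 * Complex.I) • ((scaling τ hτ).valᴴ * (scaling τ hτ).val) := by
  have e : ∀ i, ((√(τ i).im : ℝ) : ℂ) * ((√(τ i).im : ℝ) : ℂ) = ((τ i).im : ℂ) := fun i => by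
    exact_mod_cast Real.mul_self_sqrt (hτ i).le
  have e2 : ∀ i, (τ i) = (τ i).re + (τ i).im * Complex.I := fun i => (Complex.re_add_im _).symm
  rw [scaling_val, diagonal_conjTranspose, diagonal_mul_diagonal]
  ext i j
  fin_cases i <;> fin_cases j <;>
    simp [Matrix.mul_apply, Fintype.sum_sum_type, Fin.sum_univ_two, tangentBasis, Ω, J₂, e]
  · apply Complex.ext <;> simp
    ring
  · apply Complex.ext <;> simp
    ring

theorem conjTranspose_tangentMap_mul {τ : Fin 2 → ℂ} (hτ : ∀ i, 0 < (τ i).im)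
    (A : tangentAlgebra τ) (hA : A.valᵀ * Ω * A.val = Ω) :
    let C := (scaling τ hτ).val
    (tangentMap τ A)ᴴ * (Cᴴ * C) * tangentMap τ A = Cᴴ * C := by
  intro C
  have hT : (toComplex A.val)ᴴ = toComplex A.valᵀ := by
    ext i j; simp
  have h2 : (2 * Complex.I) ≠ 0 := by simp
  apply smul_right_injective _ h2
  simp only
  have hP := mem_tangentAlgebra.1 A.2
  rw [← tangentMap_apply] at hP
  rw [← Matrix.smul_mul, ← Matrix.mul_smul, ← tangentBasis_conjTranspose_mul τ hτ]
  calc (tangentMap τ A)ᴴ * ((tangentBasis τ)ᴴ * toComplex Ω * tangentBasis τ) * tangentMap τ A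
      = (tangentBasis τ * tangentMap τ A)ᴴ * toComplex Ω * (tangentBasis τ * tangentMap τ A) := by
        simp only [conjTranspose_mul, Matrix.mul_assoc]
    _ = (tangentBasis τ)ᴴ * toComplex (A.valᵀ * Ω * A.val) * tangentBasis τ := by
        rw [← hP]
        simp only [conjTranspose_mul, Matrix.mul_assoc, hT, map_mul]
    _ = _ := by rw [hA]

/-- A block of a matrix preserving the tangent plane maps the line of slope `τ` to that of slope
`σ`; a singular one is zero because the slopes are not real. -/
theorem eq_zero_of_det_eq_zero {τ σ : ℂ} (hτ : τ.im ≠ 0) (hσ : σ.im ≠ 0)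
    {B : Matrix (Fin 2) (Fin 2) ℚ} (hB : (B 1 0 : ℂ) + B 1 1 * τ = σ * (B 0 0 + B 0 1 * τ))
    (hdet : B.det = 0) : B = 0 := by
  rw [det_fin_two] at hdet
  have hdet' : (B 0 0 : ℂ) * B 1 1 - B 0 1 * B 1 0 = 0 := by exact_mod_cast hdet
  suffices h : (B 0 0 = 0 ∧ B 0 1 = 0) ∧ B 1 0 = 0 ∧ B 1 1 = 0 by
    ext i j; fin_cases i <;> fin_cases j
    exacts [h.1.1, h.1.2, h.2.1, h.2.2]
  by_cases hx : (B 0 0 : ℂ) + B 0 1 * τ = 0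
  · rw [hx, mul_zero] at hB
    exact ⟨eq_zero_of_add_mul_eq_zero hτ hx, eq_zero_of_add_mul_eq_zero hτ hB⟩
  -- otherwise eliminating between the slope equation and `det B = 0` expresses `σ` rationally
  · have h1 : ((-B 1 1 : ℚ) : ℂ) + B 0 1 * σ = 0 := by
      apply mul_right_cancel₀ hx
      push_cast
      linear_combination (-B 0 1 : ℂ) * hB - hdet'
    have h2 : ((-B 1 0 : ℚ) : ℂ) + B 0 0 * σ = 0 := by
      apply mul_right_cancel₀ hx
      push_cast
      linear_combination (-B 0 0 : ℂ) * hB + τ * hdet'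
    have h1' := eq_zero_of_add_mul_eq_zero hσ h1
    have h2' := eq_zero_of_add_mul_eq_zero hσ h2
    exact ⟨⟨h2'.2, h1'.2⟩, neg_eq_zero.1 h2'.1, neg_eq_zero.1 h1'.1⟩

/-- The blocks of a matrix preserving the tangent plane are zero or invertible, so a symplectic
matrix preserving the tangent plane falls into one of the three types. -/
theorem isType_of_mem_symplectic {τ : Fin 2 → ℂ} (hτ : ∀ i, (τ i).im ≠ 0) {N : GL4}
    (hN : N.val ∈ tangentAlgebra τ) (hs : N ∈ symplectic) :
    IsTypeI N ∨ IsTypeII N ∨ IsTypeIII N := by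
  have hP := mem_tangentAlgebra.1 hN
  rw [show coordProj * toComplex N.val * tangentBasis τ = tangentMap τ ⟨N.val, hN⟩ from rfl] at hP
  have hent : ∀ i j, (toComplex N.val * tangentBasis τ) i j =
      (tangentBasis τ * tangentMap τ ⟨N.val, hN⟩) i j := fun i j => by rw [hP]
  have h1 : (A₁ N).det = 0 → A₁ N = 0 := eq_zero_of_det_eq_zero (hτ 0) (hτ 0) (by
    simpa [tangentMap_entries, tangentBasis, Matrix.mul_apply, Fintype.sum_sum_type,
      A₁, A₂, A₃, A₄, toBlocks₁₁, toBlocks₁₂, toBlocks₂₁, toBlocks₂₂] using hent (.inl 1) 0)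
  have h2 : (A₂ N).det = 0 → A₂ N = 0 := eq_zero_of_det_eq_zero (hτ 1) (hτ 0) (by
    simpa [tangentMap_entries, tangentBasis, Matrix.mul_apply, Fintype.sum_sum_type,
      A₁, A₂, A₃, A₄, toBlocks₁₁, toBlocks₁₂, toBlocks₂₁, toBlocks₂₂] using hent (.inl 1) 1)
  have h3 : (A₃ N).det = 0 → A₃ N = 0 := eq_zero_of_det_eq_zero (hτ 0) (hτ 1) (by
    simpa [tangentMap_entries, tangentBasis, Matrix.mul_apply, Fintype.sum_sum_type,
      A₁, A₂, A₃, A₄, toBlocks₁₁, toBlocks₁₂, toBlocks₂₁, toBlocks₂₂] using hent (.inr 1) 0)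
  have h4 : (A₄ N).det = 0 → A₄ N = 0 := eq_zero_of_det_eq_zero (hτ 1) (hτ 1) (by
    simpa [tangentMap_entries, tangentBasis, Matrix.mul_apply, Fintype.sum_sum_type,
      A₁, A₂, A₃, A₄, toBlocks₁₁, toBlocks₁₂, toBlocks₂₁, toBlocks₂₂] using hent (.inr 1) 1)
  obtain ⟨h13, h24, hadj⟩ := mem_symplectic_iff.1 hs
  obtain ⟨h12, h34⟩ := det_add_det_of_mem_symplectic hs
  by_cases d1 : (A₁ N).det = 0
  · have d3 : (A₃ N).det = 1 := by linarith
    have d2 : (A₂ N).det = 1 := by linarith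
    exact .inr (.inl ⟨d3, d2, h1 d1, h4 (by linarith)⟩)
  by_cases d2 : (A₂ N).det = 0
  · have d1' : (A₁ N).det = 1 := by linarith
    have d4 : (A₄ N).det = 1 := by linarith
    exact .inl ⟨d1', d4, h2 d2, h3 (by linarith)⟩
  have d3 : (A₃ N).det ≠ 0 := fun h => d2 (by linarith)
  have d4 : (A₄ N).det ≠ 0 := fun h => d1 (by linarith)
  refine .inr (.inr ⟨⟨d1, d2, d3, d4⟩, by linarith, by linarith, h13, ?_⟩)
  rw [← smul_mul_assoc, ← smul_mul_assoc, det_smul_inv d1, det_smul_inv d3, hadj]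

namespace SurfaceData

theorem IsGhol.val_mem_tangentAlgebra {S : SurfaceData} (hS : S.IsGhol) {N : GL4}
    (hN : N ∈ S.Aut) : N.val ∈ tangentAlgebra S.τ := by
  have h0 := hS.act_tangent hN ![1, 0]
  have h1 := hS.act_tangent hN ![0, 1]
  rw [mem_tangentAlgebra]
  ext (i | i) j <;> fin_cases i <;> fin_cases j <;>
    simp [act, Matrix.mulVec, dotProduct, coordProj, tangentBasis, Matrix.mul_apply,
      Fintype.sum_sum_type] at h0 h1 ⊢
  exacts [h0.1, h1.1, h0.2, h1.2]

/-- Elements of types I, II and III of `Aut` already form a group: they are the symplectic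
elements. -/
theorem IsGhol.typeGroup_eq {S : SurfaceData} (hS : S.IsGhol) :
    S.typeGroup = S.Aut ⊓ symplectic := by
  apply le_antisymm
  · refine (Subgroup.closure_le _).2 ?_
    rintro N ⟨hN, h⟩
    refine ⟨hN, ?_⟩
    rcases h with h | h | h
    exacts [h.mem_symplectic, h.mem_symplectic, h.mem_symplectic]
  · rintro N ⟨hN, hs⟩
    exact Subgroup.subset_closure ⟨hN,
      isType_of_mem_symplectic (fun i => (hS.im_pos i).ne') (hS.val_mem_tangentAlgebra hN) hs⟩

end SurfaceData

/-- Conjugation by `C` as an automorphism of a matrix algebra. -/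
noncomputable def conjEquiv (C : GL (Fin 2) ℂ) :
    Matrix (Fin 2) (Fin 2) ℂ ≃ₐ[ℚ] Matrix (Fin 2) (Fin 2) ℂ :=
  MulSemiringAction.toAlgEquiv ℚ _ (ConjAct.toConjAct C)

theorem conjEquiv_apply (C : GL (Fin 2) ℂ) (A : Matrix (Fin 2) (Fin 2) ℂ) :
    conjEquiv C A = C.val * A * C⁻¹.val := rfl

theorem trace_conjEquiv (C : GL (Fin 2) ℂ) (A : Matrix (Fin 2) (Fin 2) ℂ) :
    (conjEquiv C A).trace = A.trace := by
  rw [conjEquiv_apply, Matrix.trace_mul_cycle, ← Units.val_mul]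
  simp

/-- A faithful unitary representation in dimension two of a group of rational `4 × 4` matrices,
with traces in `ℚ(√-3)`, compatible with negation and with minimal polynomials over `ℚ`. -/
structure PlaneRep (G : Subgroup GL4) where
  toHom : G →* Matrix (Fin 2) (Fin 2) ℂ
  injective : Function.Injective toHom
  unitary : ∀ g, (toHom g)ᴴ * toHom g = 1
  trace_mem : ∀ g, (toHom g).trace ∈ SurfaceData.QSqrtNegThree
  map_neg : ∀ g h : G, h.val = -g.val → toHom h = -toHom g
  minPoly_eq : ∀ g : G, minPoly g.val = minpoly ℚ (toHom g)

/-- Change of the unitary basis. -/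
noncomputable def PlaneRep.conj {G : Subgroup GL4} (φ : PlaneRep G) (C : GL (Fin 2) ℂ)
    (hC : C.valᴴ * C.val = 1) : PlaneRep G where
  toHom := (conjEquiv C : Matrix (Fin 2) (Fin 2) ℂ →* Matrix (Fin 2) (Fin 2) ℂ).comp φ.toHom
  injective := (conjEquiv C).injective.comp φ.injective
  unitary := fun g => by
    have hC' : C⁻¹.val = C.valᴴ := by
      have h1 : C.val * C⁻¹.val = 1 := by rw [← Units.val_mul]; simp
      calc C⁻¹.val = C.valᴴ * C.val * C⁻¹.val := by rw [hC, Matrix.one_mul]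
        _ = C.valᴴ := by rw [Matrix.mul_assoc, h1, Matrix.mul_one]
    show (conjEquiv C (φ.toHom g))ᴴ * conjEquiv C (φ.toHom g) = 1
    simp only [conjEquiv_apply, hC', conjTranspose_mul, conjTranspose_conjTranspose]
    calc C.val * ((φ.toHom g)ᴴ * C.valᴴ) * (C.val * φ.toHom g * C.valᴴ)
        = C.val * ((φ.toHom g)ᴴ * (C.valᴴ * C.val) * φ.toHom g) * C.valᴴ := by
          simp only [Matrix.mul_assoc]
      _ = 1 := by rw [hC, Matrix.mul_one, φ.unitary, Matrix.mul_one, mul_eq_one_comm.1 hC]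
  trace_mem := fun g => by
    show (conjEquiv C (φ.toHom g)).trace ∈ _
    rw [trace_conjEquiv]; exact φ.trace_mem g
  map_neg := fun g h hgh => by
    show conjEquiv C (φ.toHom h) = -conjEquiv C (φ.toHom g)
    rw [φ.map_neg g h hgh, _root_.map_neg]
  minPoly_eq := fun g => by
    show _ = minpoly ℚ (conjEquiv C (φ.toHom g))
    rw [minpoly.algEquiv_eq, φ.minPoly_eq]

theorem PlaneRep.conj_toHom {G : Subgroup GL4} (φ : PlaneRep G) (C : GL (Fin 2) ℂ)
    (hC : C.valᴴ * C.val = 1) (g : G) :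
    (φ.conj C hC).toHom g = C.val * φ.toHom g * C⁻¹.val := rfl

/-- The action on the tangent plane at the origin, in the scaled coordinates `√(Im τᵢ) uᵢ`. -/
noncomputable def SurfaceData.IsGhol.planeRep {S : SurfaceData} (hS : S.IsGhol)
    (hτ : ∀ i, S.τ i ∈ SurfaceData.QSqrtNegThree) : PlaneRep S.typeGroup where
  toHom :=
    { toFun := fun g => conjEquiv (scaling S.τ hS.im_pos) (tangentMap S.τ
        ⟨g.val.val, hS.val_mem_tangentAlgebra (hS.typeGroup_eq.le g.2).1⟩)
      map_one' := by
        rw [← map_one (conjEquiv (scaling S.τ hS.im_pos)), ← map_one (tangentMap S.τ)]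
        rfl
      map_mul' := fun g h => by
        rw [← map_mul, ← map_mul]
        rfl }
  injective := fun g h hgh => by
    have h1 := tangentMap_injective (fun i => (hS.im_pos i).ne') ((conjEquiv _).injective hgh)
    exact Subtype.ext (Units.ext (congrArg Subtype.val h1))
  unitary := fun g => by
    show (conjEquiv (scaling S.τ hS.im_pos) (tangentMap S.τ ⟨g.val.val, _⟩))ᴴ *
      conjEquiv (scaling S.τ hS.im_pos) (tangentMap S.τ ⟨g.val.val, _⟩) = 1
    have hmem := hS.typeGroup_eq.le g.2
    have h := conjTranspose_tangentMap_mul hS.im_pos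
      ⟨g.val.val, hS.val_mem_tangentAlgebra hmem.1⟩ hmem.2
    simp only [conjEquiv_apply, conjTranspose_mul]
    set C := scaling S.τ hS.im_pos
    set T := tangentMap S.τ ⟨g.val.val, hS.val_mem_tangentAlgebra hmem.1⟩
    have h1 : C.val * C⁻¹.val = 1 := by rw [← Units.val_mul]; simp
    calc (C⁻¹.val)ᴴ * (Tᴴ * C.valᴴ) * (C.val * T * C⁻¹.val)
        = (C⁻¹.val)ᴴ * (Tᴴ * (C.valᴴ * C.val) * T) * C⁻¹.val := by simp only [Matrix.mul_assoc]
      _ = (C.val * C⁻¹.val)ᴴ * (C.val * C⁻¹.val) := by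
          rw [h]; simp only [conjTranspose_mul, Matrix.mul_assoc]
      _ = 1 := by rw [h1]; simp
  trace_mem := fun g => by
    show (conjEquiv _ _).trace ∈ _
    rw [trace_conjEquiv]
    exact trace_tangentMap_mem hτ _
  map_neg := fun g h hgh => by
    show conjEquiv _ (tangentMap S.τ ⟨h.val.val, _⟩) = -conjEquiv _ (tangentMap S.τ ⟨g.val.val, _⟩)
    rw [← _root_.map_neg, ← _root_.map_neg]
    congr 2
    exact Subtype.ext (congrArg Units.val hgh)
  minPoly_eq := fun g => by
    show _ = minpoly ℚ (conjEquiv _ (tangentMap S.τ ⟨g.val.val, _⟩))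
    rw [minpoly.algEquiv_eq, minpoly.algHom_eq _ (tangentMap_injective fun i => (hS.im_pos i).ne')]
    exact minpoly.algHom_eq (tangentAlgebra S.τ).val Subtype.val_injective
      ⟨g.val.val, hS.val_mem_tangentAlgebra (hS.typeGroup_eq.le g.2).1⟩

/-! ### Integers of `ℚ(√-3)` and matrices of finite order -/

theorem exists_rat_of_mem_QSqrtNegThree {x : ℂ} (hx : x ∈ SurfaceData.QSqrtNegThree) :
    ∃ p q : ℚ, x = p + q * ((Real.sqrt 3 : ℂ) * Complex.I) := by
  have hsq : ((Real.sqrt 3 : ℂ) * Complex.I) ^ 2 = -3 := by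
    have : (Real.sqrt 3 : ℂ) ^ 2 = 3 := by exact_mod_cast Real.sq_sqrt (by norm_num : (0 : ℝ) ≤ 3)
    rw [mul_pow, this, Complex.I_sq]; norm_num
  have hint : IsIntegral ℚ ((Real.sqrt 3 : ℂ) * Complex.I) := by
    refine ⟨X ^ 2 + 3, by monicity!, ?_⟩
    simp [hsq]
  rw [SurfaceData.QSqrtNegThree, ← IntermediateField.mem_toSubalgebra,
    IntermediateField.adjoin_simple_toSubalgebra_of_isAlgebraic hint.isAlgebraic] at hx
  induction hx using Algebra.adjoin_induction with
  | mem x hx => exact ⟨0, 1, by simpa using hx⟩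
  | algebraMap r => exact ⟨r, 0, by simp⟩
  | add x y _ _ hx hy =>
    obtain ⟨p, q, rfl⟩ := hx
    obtain ⟨p', q', rfl⟩ := hy
    exact ⟨p + p', q + q', by push_cast; ring⟩
  | mul x y _ _ hx hy =>
    obtain ⟨p, q, rfl⟩ := hx
    obtain ⟨p', q', rfl⟩ := hy
    exact ⟨p * p' - 3 * q * q', p * q' + q * p', by
      push_cast; linear_combination (q : ℂ) * q' * hsq⟩

theorem exists_int_of_isIntegral {r : ℚ} (h : IsIntegral ℤ (r : ℂ)) : ∃ n : ℤ, (n : ℚ) = r := by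
  have h' : IsIntegral ℤ r :=
    (isIntegral_algebraMap_iff (B := ℂ) (algebraMap ℚ ℂ).injective).1 h
  exact IsIntegrallyClosed.isIntegral_iff.1 h'

/-- An integer of `ℚ(√-3)` in the closed unit disc is zero or a sixth root of unity. -/
theorem eq_zero_or_pow_six_eq_one {x : ℂ} (hx : x ∈ SurfaceData.QSqrtNegThree)
    (hint : IsIntegral ℤ x) (hle : Complex.normSq x ≤ 1) : x = 0 ∨ x ^ 6 = 1 := by
  obtain ⟨p, q, hpq⟩ := exists_rat_of_mem_QSqrtNegThree hx
  have h3 : Real.sqrt 3 * Real.sqrt 3 = 3 := Real.mul_self_sqrt (by norm_num)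
  have hre : x.re = p := by simp [hpq]
  have him : x.im = q * Real.sqrt 3 := by simp [hpq]
  have hconj : IsIntegral ℤ ((starRingEnd ℂ) x) :=
    hint.map (Complex.conjAe.restrictScalars ℤ : ℂ →ₐ[ℤ] ℂ)
  have hN : (x * (starRingEnd ℂ) x) = ((p ^ 2 + 3 * q ^ 2 : ℚ) : ℂ) := by
    rw [Complex.mul_conj, Complex.normSq_apply, hre, him]
    push_cast
    have h3' : (Real.sqrt 3 : ℂ) * Real.sqrt 3 = 3 := by exact_mod_cast h3
    linear_combination (q : ℂ) ^ 2 * h3'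
  have hT : (x + (starRingEnd ℂ) x) = ((2 * p : ℚ) : ℂ) := by
    rw [Complex.add_conj, hre]; push_cast; ring
  obtain ⟨n, hn⟩ := exists_int_of_isIntegral (hN ▸ hint.mul hconj)
  obtain ⟨t, ht⟩ := exists_int_of_isIntegral (hT ▸ hint.add hconj)
  have hn1 : (n : ℚ) ≤ 1 := by
    have h : ((p ^ 2 + 3 * q ^ 2 : ℚ) : ℝ) ≤ 1 := by
      rw [Complex.mul_conj] at hN
      have hN' : Complex.normSq x = ((p ^ 2 + 3 * q ^ 2 : ℚ) : ℝ) := by exact_mod_cast hN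
      rwa [← hN']
    rw [hn]; exact_mod_cast h
  have hn0 : (0 : ℚ) ≤ n := by rw [hn]; positivity
  have hn01 : n = 0 ∨ n = 1 := by
    have h1 : n ≤ 1 := by exact_mod_cast hn1
    have h0 : 0 ≤ n := by exact_mod_cast hn0
    omega
  rcases hn01 with rfl | rfl
  · left
    rw [← hn, Complex.mul_conj] at hN
    simpa using hN
  right
  have hnorm : p ^ 2 + 3 * q ^ 2 = 1 := by rw [← hn]; simp
  -- `x` is a root of `X² - t X + 1` with `|t| ≤ 2`
  have hquad : x ^ 2 - t * x + 1 = 0 := by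
    have ht' : (t : ℂ) = x + (starRingEnd ℂ) x := by rw [hT, ← ht]; simp
    have hN1 : x * (starRingEnd ℂ) x = 1 := by rw [hN, hnorm]; simp
    rw [ht']; linear_combination -hN1
  have htt : (t : ℚ) ^ 2 ≤ 4 := by rw [ht]; nlinarith [sq_nonneg q]
  have htt' : t ^ 2 ≤ 4 := by exact_mod_cast htt
  have hl : -2 ≤ t := by nlinarith
  have hu : t ≤ 2 := by nlinarith
  have ht0 : t ≠ 0 := by
    rintro rfl
    have hp : p = 0 := by simpa using ht.symm
    -- `3 q² = 1` has no rational solution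
    have h9 : (3 * q) ^ 2 = 3 := by rw [hp] at hnorm; linear_combination 3 * hnorm
    have hirr := Nat.Prime.irrational_sqrt Nat.prime_three
    apply hirr
    refine ⟨|3 * q|, ?_⟩
    have : ((3 * q : ℚ) : ℝ) ^ 2 = 3 := by exact_mod_cast h9
    rw [Rat.cast_abs, ← Real.sqrt_sq_eq_abs, this]
    norm_num
  have hcases : t = -2 ∨ t = -1 ∨ t = 1 ∨ t = 2 := by omega
  rcases hcases with rfl | rfl | rfl | rfl <;> push_cast at hquad
  · have h : x = -1 := by
      have : (x + 1) ^ 2 = 0 := by linear_combination hquad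
      linear_combination pow_eq_zero_iff (two_ne_zero) |>.1 this
    rw [h]; norm_num
  · linear_combination (x - 1) * (x ^ 3 + 1) * hquad
  · linear_combination (x + 1) * (x ^ 3 - 1) * hquad
  · have h : x = 1 := by
      have : (x - 1) ^ 2 = 0 := by linear_combination hquad
      linear_combination pow_eq_zero_iff (two_ne_zero) |>.1 this
    rw [h]; norm_num

/-- The trace of a matrix of finite order is a sum of roots of unity. -/
theorem isIntegral_trace_of_pow_eq_one {A : Matrix (Fin 2) (Fin 2) ℂ} {n : ℕ} (hn : n ≠ 0)
    (hA : A ^ n = 1) : IsIntegral ℤ A.trace := by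
  rw [trace_eq_sum_roots_charpoly]
  refine IsIntegral.multiset_sum fun r hr => ?_
  have h1 : r ∈ spectrum ℂ A := mem_spectrum_iff_isRoot_charpoly.2 (isRoot_of_mem_roots hr)
  have h2 := spectrum.pow_mem_pow A n h1
  rw [hA, spectrum.one_eq, Set.mem_singleton_iff] at h2
  exact IsIntegral.of_pow (Nat.pos_of_ne_zero hn) (h2 ▸ isIntegral_one)

/-! ### Unitary matrices of size two -/

theorem normSq_add_of_unitary {A : Matrix (Fin 2) (Fin 2) ℂ} (hA : Aᴴ * A = 1) :
    Complex.normSq (A 0 0) + Complex.normSq (A 1 0) = 1 ∧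
    Complex.normSq (A 0 1) + Complex.normSq (A 1 1) = 1 ∧
    Complex.normSq (A 0 0) + Complex.normSq (A 0 1) = 1 := by
  have h0 := congrFun (congrFun hA 0) 0
  have h1 := congrFun (congrFun hA 1) 1
  have h2 := congrFun (congrFun (show A * Aᴴ = 1 from mul_eq_one_comm.1 hA) 0) 0
  simp only [Matrix.mul_apply, Fin.sum_univ_two, conjTranspose_apply, one_apply_eq,
    RCLike.star_def, ← Complex.normSq_eq_conj_mul_self, Complex.mul_conj] at h0 h1 h2
  exact ⟨by exact_mod_cast h0, by exact_mod_cast h1, by exact_mod_cast h2⟩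

/-- A unitary matrix with eigenvalue `s` is diagonal, with first entry `s`, in some unitary
basis. -/
theorem exists_unitary_diagonalize {A : Matrix (Fin 2) (Fin 2) ℂ} (hA : Aᴴ * A = 1) {s : ℂ}
    (hs : (A - s • 1).det = 0) :
    ∃ (C : GL (Fin 2) ℂ) (b : ℂ), C.valᴴ * C.val = 1 ∧ C.val * A * C⁻¹.val = !![s, 0; 0, b] := by
  obtain ⟨v, hv0, hv⟩ := exists_mulVec_eq_zero_iff.2 hs
  have hpos : 0 < Complex.normSq (v 0) + Complex.normSq (v 1) := by
    rcases (add_nonneg (Complex.normSq_nonneg (v 0)) (Complex.normSq_nonneg (v 1))).lt_or_eq with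
      h | h
    · exact h
    · exfalso
      apply hv0
      have h0 : Complex.normSq (v 0) = 0 := by
        linarith [Complex.normSq_nonneg (v 0), Complex.normSq_nonneg (v 1)]
      have h1 : Complex.normSq (v 1) = 0 := by
        linarith [Complex.normSq_nonneg (v 0), Complex.normSq_nonneg (v 1)]
      ext i; fin_cases i
      exacts [Complex.normSq_eq_zero.1 h0, Complex.normSq_eq_zero.1 h1]
  set r : ℝ := √(Complex.normSq (v 0) + Complex.normSq (v 1)) with hr
  have hrpos : 0 < r := Real.sqrt_pos.2 hpos
  have hrr : r * r = Complex.normSq (v 0) + Complex.normSq (v 1) := Real.mul_self_sqrt hpos.le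
  have hrC : (r : ℂ) ≠ 0 := by exact_mod_cast hrpos.ne'
  obtain ⟨p, hp⟩ : ∃ p, p = v 0 / r := ⟨_, rfl⟩
  obtain ⟨q, hq⟩ : ∃ q, q = v 1 / r := ⟨_, rfl⟩
  have hpq : star p * p + star q * q = 1 := by
    simp only [RCLike.star_def]
    rw [← Complex.normSq_eq_conj_mul_self,
      ← Complex.normSq_eq_conj_mul_self, hp, hq, Complex.normSq_div, Complex.normSq_div,
      Complex.normSq_ofReal, hrr]
    norm_cast
    field_simp
  have he0 : A 0 0 * p + A 0 1 * q = s * p := by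
    have h := congrFun hv 0
    simp [Matrix.mulVec, dotProduct, Fin.sum_univ_two] at h
    rw [hp, hq]; field_simp; linear_combination h
  have he1 : A 1 0 * p + A 1 1 * q = s * q := by
    have h := congrFun hv 1
    simp [Matrix.mulVec, dotProduct, Fin.sum_univ_two] at h
    rw [hp, hq]; field_simp; linear_combination h
  -- the rows of `V` are an orthonormal basis whose first vector is the conjugate eigenvector
  set V : Matrix (Fin 2) (Fin 2) ℂ := !![star p, star q; -q, p] with hV
  have hVV : V * Vᴴ = 1 := by
    ext i j; fin_cases i <;> fin_cases j <;>
      simp [hV, Matrix.mul_apply, Fin.sum_univ_two] <;>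
      simp only [RCLike.star_def] at hpq <;> first | linear_combination hpq | ring
  have hVV' : Vᴴ * V = 1 := mul_eq_one_comm.1 hVV
  set B := V * A * Vᴴ with hB
  have hBB : Bᴴ * B = 1 := by
    calc Bᴴ * B = V * (Aᴴ * (Vᴴ * V) * A) * Vᴴ := by
          simp only [hB, conjTranspose_mul, conjTranspose_conjTranspose, Matrix.mul_assoc]
      _ = 1 := by rw [hVV', Matrix.mul_one, hA, Matrix.mul_one, hVV]
  have hB00 : B 0 0 = s := by
    rw [hB]
    simp [hV, Matrix.mul_apply, Fin.sum_univ_two, Matrix.vecMul, dotProduct]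
    simp only [RCLike.star_def] at hpq
    linear_combination (starRingEnd ℂ p) * he0 + (starRingEnd ℂ q) * he1 + s * hpq
  have hB10 : B 1 0 = 0 := by
    rw [hB]
    simp [hV, Matrix.mul_apply, Fin.sum_univ_two, Matrix.vecMul, dotProduct]
    linear_combination (-q) * he0 + p * he1
  obtain ⟨hn1, -, hn3⟩ := normSq_add_of_unitary hBB
  have hB01 : B 0 1 = 0 := by
    rw [hB10, map_zero] at hn1
    exact Complex.normSq_eq_zero.1 (by linarith)
  refine ⟨⟨V, Vᴴ, hVV, hVV'⟩, B 1 1, hVV', ?_⟩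
  show V * A * Vᴴ = _
  rw [← hB]
  ext i j; fin_cases i <;> fin_cases j
  exacts [hB00, hB01, hB10, rfl]

/-! ### Minimal polynomials over the rationals -/

/-- A rational polynomial with simple roots is the minimal polynomial of `A` if it annihilates `A`
and each of its roots is an eigenvalue of `A` or the conjugate of one. -/
theorem minpoly_eq_of_roots {A : Matrix (Fin 2) (Fin 2) ℂ} {p : ℚ[X]} (hp : p.Monic)
    (hdvd : p ∣ X ^ 12 - 1) (hA : aeval A p = 0)
    (hroots : ∀ x : ℂ, aeval x p = 0 →
      (A - x • 1).det = 0 ∨ (A - (starRingEnd ℂ) x • 1).det = 0) : minpoly ℚ A = p := by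
  have hAint : IsIntegral ℚ A := ⟨p, hp, hA⟩
  have heig : ∀ x : ℂ, (A - x • 1).det = 0 → aeval x (minpoly ℚ A) = 0 := by
    intro x hx
    have h1 : x ∈ spectrum ℂ A := by
      rw [spectrum.mem_iff, Matrix.isUnit_iff_isUnit_det, Algebra.algebraMap_eq_smul_one,
        ← neg_sub, det_neg, hx]
      simp
    have h2 := spectrum.subset_polynomial_aeval A ((minpoly ℚ A).map (algebraMap ℚ ℂ))
      ⟨x, h1, rfl⟩
    rw [aeval_map_algebraMap, minpoly.aeval, spectrum.zero_eq, Set.mem_singleton_iff] at h2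
    simpa [eval_map_algebraMap] using h2
  have hconj : ∀ x : ℂ, aeval ((starRingEnd ℂ) x) (minpoly ℚ A) = 0 →
      aeval x (minpoly ℚ A) = 0 := by
    intro x hx
    have h := aeval_algHom_apply (Complex.conjAe.restrictScalars ℚ : ℂ →ₐ[ℚ] ℂ) x (minpoly ℚ A)
    have h' : aeval ((starRingEnd ℂ) x) (minpoly ℚ A) =
        (starRingEnd ℂ) (aeval x (minpoly ℚ A)) := h
    rw [hx] at h'
    simpa using h'.symm
  have hsep : p.Separable := Separable.of_dvd (X_pow_sub_one_separable_iff.2 (by norm_num)) hdvd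
  refine eq_of_monic_of_associated (minpoly.monic hAint) hp
    (associated_of_dvd_dvd (minpoly.dvd ℚ A hA) ?_)
  rw [← map_dvd_map' (algebraMap ℚ ℂ)]
  refine (IsAlgClosed.splits _).dvd_of_roots_le_roots (hp.map _).ne_zero ?_
  rw [Multiset.le_iff_subset (nodup_roots (hsep.map (f := algebraMap ℚ ℂ)))]
  intro x hx
  rw [mem_roots ((minpoly.monic hAint).map _).ne_zero, IsRoot.def, eval_map_algebraMap]
  have hx' := isRoot_of_mem_roots hx
  rw [IsRoot.def, eval_map_algebraMap] at hx'
  rcases hroots x hx' with h | h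
  exacts [heig x h, hconj x (heig _ h)]

/-! ### Diagonalizing the given element -/

/-- A unitary matrix with minimal polynomial `(X - s)(X² - s X + 1)`, `s = ±1`, has eigenvalues
`s` and `s z` with `z` a primitive sixth root of unity. -/
theorem exists_diagonalize_of_minpoly {A : Matrix (Fin 2) (Fin 2) ℂ} (hA : Aᴴ * A = 1) {s : ℚ}
    (hs : s ^ 2 = 1) (hmin : minpoly ℚ A = (X - C s) * (X ^ 2 - C s * X + 1)) :
    ∃ (U : GL (Fin 2) ℂ) (z : ℂ), U.valᴴ * U.val = 1 ∧ z ^ 2 - z + 1 = 0 ∧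
      U.val * A * U⁻¹.val = !![(s : ℂ), 0; 0, s * z] := by
  have hs' : (s : ℂ) ^ 2 = 1 := by exact_mod_cast hs
  have hq2 : (X ^ 2 - C s * X + 1 : ℚ[X]).Monic := by monicity!
  have hd2 : (X ^ 2 - C s * X + 1 : ℚ[X]).natDegree = 2 := by compute_degree!
  have hd3 : (minpoly ℚ A).natDegree = 3 := by
    rw [hmin, (monic_X_sub_C s).natDegree_mul hq2, hd2, natDegree_X_sub_C]
  have hlow : ∀ q : ℚ[X], q.Monic → q.natDegree < 3 → aeval A q ≠ 0 := fun q hq hd h => by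
    have := natDegree_le_natDegree (minpoly.min ℚ A hq h)
    omega
  have hz : aeval A ((X - C s) * (X ^ 2 - C s * X + 1)) = 0 := hmin ▸ minpoly.aeval ℚ A
  have hX : aeval A (X - C s) = A - (s : ℂ) • 1 := by
    simp [Algebra.algebraMap_eq_smul_one, Rat.cast_smul_eq_qsmul]
  have hdet : (A - (s : ℂ) • 1).det = 0 := by
    by_contra hne
    refine hlow _ hq2 (by omega) ?_
    rw [map_mul, hX] at hz
    have hu : IsUnit (A - (s : ℂ) • 1) := (isUnit_iff_isUnit_det _).2 (isUnit_iff_ne_zero.2 hne)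
    exact hu.mul_right_eq_zero.1 hz
  obtain ⟨U, b, hU, hb⟩ := exists_unitary_diagonalize hA hdet
  have hconj : ∀ q : ℚ[X], aeval !![(s : ℂ), 0; 0, b] q = conjEquiv U (aeval A q) := fun q => by
    rw [← hb, ← conjEquiv_apply, aeval_algHom_apply]
  have hbs : b ≠ s := by
    rintro rfl
    refine hlow _ (monic_X_sub_C s) (by rw [natDegree_X_sub_C]; norm_num) ?_
    apply (conjEquiv U).injective
    rw [← hconj, map_zero]
    have : !![(s : ℂ), 0; 0, (s : ℂ)] = algebraMap ℚ _ s := by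
      ext i j; fin_cases i <;> fin_cases j <;> simp [Matrix.algebraMap_matrix_apply]
    simp [this]
  have hbq : (b - s) * (b ^ 2 - s * b + 1) = 0 := by
    have h := hconj ((X - C s) * (X ^ 2 - C s * X + 1))
    rw [hz, map_zero] at h
    have h1 := congrFun (congrFun h 1) 1
    simpa [pow_two, Matrix.mul_apply, Fin.sum_univ_two, Matrix.algebraMap_matrix_apply] using h1
  have hb2 := (mul_eq_zero.1 hbq).resolve_left (sub_ne_zero.2 hbs)
  refine ⟨U, s * b, hU, by linear_combination hb2 + b ^ 2 * hs', ?_⟩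
  rw [hb]
  ext i j; fin_cases i <;> fin_cases j <;> simp
  linear_combination -b * hs'

/-! ### The group is monomial -/

section monomial

variable {G : Subgroup GL4} {φ : PlaneRep G} {M : G} {s z : ℂ}

theorem isPrimitiveRoot_six (hz : z ^ 2 - z + 1 = 0) : IsPrimitiveRoot z 6 := by
  rw [← isRoot_cyclotomic_iff (R := ℂ), cyclotomic_six]
  simpa using hz

/-- If `M` acts as `diag(s, s z)`, the diagonal entries of every element are integers of `ℚ(√-3)`
in the unit disc. The first one is recovered from the traces of `g` and `g M` because `1 - z` is a
unit. -/
theorem diagonal_entries [Finite G] (hs : s ^ 2 = 1) (hz : z ^ 2 - z + 1 = 0)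
    (hM : φ.toHom M = !![s, 0; 0, s * z]) (g : G) :
    (φ.toHom g 0 0 = 0 ∨ φ.toHom g 0 0 ^ 6 = 1) ∧ (φ.toHom g 1 1 = 0 ∨ φ.toHom g 1 1 ^ 6 = 1) := by
  set K := SurfaceData.QSqrtNegThree
  have htr : ∀ h : G, IsIntegral ℤ (φ.toHom h).trace := fun h =>
    isIntegral_trace_of_pow_eq_one (Nat.card_pos (α := G)).ne'
      (by rw [← map_pow, pow_card_eq_one', map_one])
  have hsK : s ∈ K := by
    rcases sq_eq_sq_iff_eq_or_eq_neg.1 (hs.trans (one_pow 2).symm) with rfl | rfl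
    exacts [one_mem K, neg_mem (one_mem K)]
  have hsI : IsIntegral ℤ s := IsIntegral.of_pow two_pos (hs ▸ isIntegral_one)
  have hzI : IsIntegral ℤ z := by
    refine ⟨X ^ 2 - X + 1, by monicity!, ?_⟩
    simpa using hz
  have hzK : z ∈ K := by
    have h : z = s * (φ.toHom M).trace - 1 := by
      rw [hM, trace_fin_two]; simp; linear_combination (-1 - z) * hs
    rw [h]
    exact sub_mem (mul_mem hsK (φ.trace_mem M)) (one_mem K)
  have ha : φ.toHom g 0 0 = z * (s * (φ.toHom (g * M)).trace - z * (φ.toHom g).trace) := by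
    rw [map_mul, hM, trace_fin_two, trace_fin_two]
    simp only [Matrix.mul_apply, Fin.sum_univ_two, of_apply, cons_val', cons_val_zero,
      cons_val_one, cons_val_fin_one]
    linear_combination (-z * φ.toHom g 0 0 - z ^ 2 * φ.toHom g 1 1) * hs + φ.toHom g 0 0 * hz
  have hd : φ.toHom g 1 1 = (φ.toHom g).trace - φ.toHom g 0 0 := by rw [trace_fin_two]; ring
  have haK : φ.toHom g 0 0 ∈ K := by
    rw [ha]
    exact mul_mem hzK (sub_mem (mul_mem hsK (φ.trace_mem _)) (mul_mem hzK (φ.trace_mem _)))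
  have haI : IsIntegral ℤ (φ.toHom g 0 0) := by
    rw [ha]
    exact hzI.mul ((hsI.mul (htr _)).sub (hzI.mul (htr _)))
  obtain ⟨h1, h2, -⟩ := normSq_add_of_unitary (φ.unitary g)
  refine ⟨eq_zero_or_pow_six_eq_one haK haI ?_, eq_zero_or_pow_six_eq_one
    (hd ▸ sub_mem (φ.trace_mem g) haK) (hd ▸ (htr g).sub haI) ?_⟩
  · linarith [Complex.normSq_nonneg (φ.toHom g 1 0)]
  · linarith [Complex.normSq_nonneg (φ.toHom g 0 1)]

theorem normSq_eq_one_of_pow_six {x : ℂ} (hx : x ^ 6 = 1) : Complex.normSq x = 1 := by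
  have h : Complex.normSq x ^ 6 = 1 := by rw [← map_pow, hx, map_one]
  exact (pow_eq_one_iff_of_nonneg (Complex.normSq_nonneg x) (by norm_num)).1 h

theorem diagonal_or_antidiagonal [Finite G] (hs : s ^ 2 = 1) (hz : z ^ 2 - z + 1 = 0)
    (hM : φ.toHom M = !![s, 0; 0, s * z]) (g : G) :
    (∃ a d : ℂ, a ^ 6 = 1 ∧ d ^ 6 = 1 ∧ φ.toHom g = !![a, 0; 0, d]) ∨
      ∃ b c : ℂ, Complex.normSq c = 1 ∧ φ.toHom g = !![0, b; c, 0] := by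
  obtain ⟨ha, hd⟩ := diagonal_entries hs hz hM g
  obtain ⟨h1, h2, h3⟩ := normSq_add_of_unitary (φ.unitary g)
  rcases ha with ha | ha
  · right
    rw [ha, map_zero] at h1 h3
    have hd0 : φ.toHom g 1 1 = 0 := Complex.normSq_eq_zero.1 (by linarith)
    refine ⟨φ.toHom g 0 1, φ.toHom g 1 0, by linarith, ?_⟩
    ext i j; fin_cases i <;> fin_cases j
    exacts [ha, rfl, rfl, hd0]
  · left
    have ha1 := normSq_eq_one_of_pow_six ha
    have hb0 : φ.toHom g 0 1 = 0 := Complex.normSq_eq_zero.1 (by linarith)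
    have hc0 : φ.toHom g 1 0 = 0 := Complex.normSq_eq_zero.1 (by linarith)
    have hd' : φ.toHom g 1 1 ≠ 0 := fun h => by
      rw [hb0, h, map_zero] at h2; norm_num at h2
    refine ⟨φ.toHom g 0 0, φ.toHom g 1 1, ha, hd.resolve_left hd', ?_⟩
    ext i j; fin_cases i <;> fin_cases j
    exacts [rfl, hb0, hc0, rfl]

/-- The normal form of the representation: `M` is diagonal and `ι` interchanges the two basis
vectors. -/
structure NormalForm (φ : PlaneRep G) (M i : G) (s z : ℂ) : Prop where
  s_sq : s ^ 2 = 1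
  z_sq : z ^ 2 - z + 1 = 0
  map_M : φ.toHom M = !![s, 0; 0, s * z]
  map_i : φ.toHom i = !![0, 1; 1, 0]

theorem exists_normalForm [Finite G] (φ : PlaneRep G) (M i : G) (hi : i * i = 1)
    (hiM : i * M ≠ M * i) {s : ℚ} (hs : s ^ 2 = 1)
    (hmin : minPoly M.val = (X - C s) * (X ^ 2 - C s * X + 1)) :
    ∃ (ψ : PlaneRep G) (z : ℂ), NormalForm ψ M i s z := by
  rw [φ.minPoly_eq] at hmin
  have hs' : (s : ℂ) ^ 2 = 1 := by exact_mod_cast hs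
  obtain ⟨U, z, hU, hz, hUM⟩ := exists_diagonalize_of_minpoly (φ.unitary M) hs hmin
  have hM : (φ.conj U hU).toHom M = !![(s : ℂ), 0; 0, s * z] := hUM
  set φ₁ := φ.conj U hU
  obtain ⟨a, d, -, -, h⟩ | ⟨b, c, hc, h⟩ := diagonal_or_antidiagonal hs' hz hM i
  · refine absurd (φ₁.injective ?_) hiM
    rw [map_mul, map_mul, h, hM]
    ext i j; fin_cases i <;> fin_cases j <;> simp [mul_comm]
  have hbc : c * b = 1 := by
    have h1 : φ₁.toHom i * φ₁.toHom i = 1 := by rw [← map_mul, hi, map_one]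
    rw [h] at h1
    simpa [Matrix.mul_apply, Fin.sum_univ_two] using congrFun (congrFun h1 1) 1
  have hbc' : b * c = 1 := by rw [mul_comm, hbc]
  let V : GL (Fin 2) ℂ := ⟨!![c, 0; 0, 1], !![b, 0; 0, 1],
    by ext i j; fin_cases i <;> fin_cases j <;> simp [hbc],
    by ext i j; fin_cases i <;> fin_cases j <;> simp [hbc']⟩
  have hV : V.valᴴ * V.val = 1 := by
    have hcc : (starRingEnd ℂ) c * c = 1 := by
      rw [← Complex.normSq_eq_conj_mul_self, hc, Complex.ofReal_one]
    ext i j; fin_cases i <;> fin_cases j <;>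
      simp [V, Matrix.mul_apply, Fin.sum_univ_two, hcc]
  refine ⟨φ₁.conj V hV, z, hs', hz, ?_, ?_⟩
  · rw [PlaneRep.conj_toHom, hM]
    show !![c, 0; 0, 1] * !![(s : ℂ), 0; 0, s * z] * !![b, 0; 0, 1] = _
    ext i j; fin_cases i <;> fin_cases j <;> simp
    linear_combination (s : ℂ) * hbc
  · rw [PlaneRep.conj_toHom, h]
    show !![c, 0; 0, 1] * !![0, b; c, 0] * !![b, 0; 0, 1] = _
    ext i j; fin_cases i <;> fin_cases j <;> simp [hbc]

variable {i : G}

theorem pow_sixth (hz : z ^ 2 - z + 1 = 0) :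
    z ^ 2 = z - 1 ∧ z ^ 3 = -1 ∧ z ^ 4 = -z ∧ z ^ 5 = 1 - z ∧ z ^ 6 = 1 := by
  refine ⟨?_, ?_, ?_, ?_, ?_⟩
  · linear_combination hz
  · linear_combination (z + 1) * hz
  · linear_combination (z ^ 2 + z) * hz
  · linear_combination (z ^ 3 + z ^ 2 - 1) * hz
  · linear_combination (z ^ 4 + z ^ 3 - z - 1) * hz

theorem NormalForm.diagonal_or_diagonal_mul [Finite G] (h : NormalForm φ M i s z) (g : G) :
    (∃ j < 6, ∃ k < 6, φ.toHom g = !![z ^ j, 0; 0, z ^ k]) ∨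
      ∃ j < 6, ∃ k < 6, φ.toHom (g * i) = !![z ^ j, 0; 0, z ^ k] := by
  have hroot := isPrimitiveRoot_six h.z_sq
  have key : ∀ g : G, (∃ a d : ℂ, a ^ 6 = 1 ∧ d ^ 6 = 1 ∧ φ.toHom g = !![a, 0; 0, d]) →
      ∃ j < 6, ∃ k < 6, φ.toHom g = !![z ^ j, 0; 0, z ^ k] := by
    rintro g ⟨a, d, ha, hd, hg⟩
    obtain ⟨j, hj, rfl⟩ := hroot.eq_pow_of_pow_eq_one ha
    obtain ⟨k, hk, rfl⟩ := hroot.eq_pow_of_pow_eq_one hd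
    exact ⟨j, hj, k, hk, hg⟩
  rcases diagonal_or_antidiagonal h.s_sq h.z_sq h.map_M g with hg | ⟨b, c, hc, hg⟩
  · exact .inl (key g hg)
  · right
    apply key
    rcases diagonal_or_antidiagonal h.s_sq h.z_sq h.map_M (g * i) with hg' | ⟨b', c', hc', hg'⟩
    · exact hg'
    · exfalso
      rw [map_mul, hg, h.map_i] at hg'
      have h1 := congrFun (congrFun hg' 1) 1
      simp at h1
      simp [h1] at hc

/-- Elements with equal images up to sign agree up to sign. -/
theorem PlaneRep.eq_or_eq_neg (φ : PlaneRep G) (hneg : ∀ g ∈ G, -g ∈ G) {g w : G}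
    (h : φ.toHom g = φ.toHom w ∨ φ.toHom g = -φ.toHom w) : g.val = w.val ∨ g.val = -w.val := by
  rcases h with h | h
  · exact .inl (congrArg _ (φ.injective h))
  · right
    rw [← φ.map_neg w ⟨-w.val, hneg _ w.2⟩ rfl] at h
    exact congrArg Subtype.val (φ.injective h)

theorem antidiagonal_mul_diagonal_mul (a d : ℂ) :
    !![0, 1; 1, 0] * !![a, 0; 0, d] * !![0, 1; 1, 0] = !![d, 0; 0, a] := by
  ext i j; fin_cases i <;> fin_cases j <;> simp

theorem diagonal_pow (a d : ℂ) (n : ℕ) : !![a, 0; 0, d] ^ n = !![a ^ n, 0; 0, d ^ n] := by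
  induction n with
  | zero => ext i j; fin_cases i <;> fin_cases j <;> simp
  | succ n ih => rw [pow_succ, ih]; ext i j; fin_cases i <;> fin_cases j <;> simp [pow_succ]

theorem NormalForm.map_eta_pow_mul (h : NormalForm φ M i s z) (α c : ℕ) :
    φ.toHom (((i * M ^ 5) * (i * M ^ 2)) ^ α * M ^ c) =
      s ^ (α + c) • !![z ^ (5 * α), 0; 0, z ^ (2 * α + c)] := by
  have hs5 : s ^ 5 = s := by linear_combination (s ^ 3 + s) * h.s_sq
  have e : φ.toHom ((i * M ^ 5) * (i * M ^ 2)) = !![s * z ^ 5, 0; 0, s * z ^ 2] := by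
    rw [← mul_assoc, map_mul, map_mul, map_mul, map_pow, map_pow, h.map_i, h.map_M, diagonal_pow,
      diagonal_pow, antidiagonal_mul_diagonal_mul]
    ext i j; fin_cases i <;> fin_cases j <;> simp [mul_pow, hs5, h.s_sq]
  rw [map_mul, map_pow, map_pow, e, h.map_M, diagonal_pow, diagonal_pow]
  ext i j; fin_cases i <;> fin_cases j <;> simp
  · ring
  · ring

/-- Every pair of exponents modulo six is realised, up to sign and interchange, by a word
`η ^ α * M ^ c`. -/
theorem exists_exponents : ∀ j k : Fin 6, ∃ (m : Fin 2) (α : Fin 6) (c : Fin 2),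
    ((j : ℕ) % 6 = (5 * α + 3 * m) % 6 ∧ (k : ℕ) % 6 = (2 * α + c + 3 * m) % 6) ∨
    ((k : ℕ) % 6 = (5 * α + 3 * m) % 6 ∧ (j : ℕ) % 6 = (2 * α + c + 3 * m) % 6) := by
  decide

/-- A diagonal element is, up to sign, a word `η ^ α * M ^ c` or its conjugate by `ι`. The signs
come from `z ^ 3 = -1` and from the powers of `s`. -/
theorem NormalForm.exists_word_of_diagonal (h : NormalForm φ M i s z) (hneg : ∀ g ∈ G, -g ∈ G)
    {g : G} {j k : ℕ} (hj : j < 6) (hk : k < 6) (hg : φ.toHom g = !![z ^ j, 0; 0, z ^ k]) :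
    ∃ ε α c : ℕ, ε ≤ 1 ∧ c ≤ 1 ∧ α ≤ 5 ∧
      (g.val = i.val ^ ε * ((i.val * M.val ^ 5) * (i.val * M.val ^ 2)) ^ α * M.val ^ c * i.val ^ ε ∨
        g.val =
          -(i.val ^ ε * ((i.val * M.val ^ 5) * (i.val * M.val ^ 2)) ^ α * M.val ^ c * i.val ^ ε)) := by
  obtain ⟨m, α, c, hmc⟩ := exists_exponents ⟨j, hj⟩ ⟨k, hk⟩
  obtain ⟨-, h3, -, -, h6⟩ := pow_sixth h.z_sq
  have hmod : ∀ a b : ℕ, a % 6 = b % 6 → z ^ a = z ^ b := fun a b hab => by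
    rw [← Nat.div_add_mod a 6, ← Nat.div_add_mod b 6, pow_add, pow_add, pow_mul, pow_mul, h6,
      one_pow, one_pow, hab]
  have hsign : ∀ {x y : ℂ} (A : Matrix (Fin 2) (Fin 2) ℂ), x ^ 2 = 1 → y ^ 2 = 1 →
      x • A = y • A ∨ x • A = -(y • A) := by
    intro x y A hx hy
    rcases sq_eq_sq_iff_eq_or_eq_neg.1 (hx.trans hy.symm) with rfl | rfl
    exacts [.inl rfl, .inr (neg_smul _ _)]
  have hs2 : (s ^ ((α : ℕ) + c)) ^ 2 = 1 := by rw [← pow_mul, mul_comm, pow_mul, h.s_sq, one_pow]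
  have hm2 : ((-1 : ℂ) ^ (m : ℕ)) ^ 2 = 1 := by rw [← pow_mul, mul_comm, pow_mul]; simp
  have hm3 : ∀ a : ℕ, z ^ (a + 3 * m) = (-1) ^ (m : ℕ) * z ^ a := fun a => by
    rw [pow_add, pow_mul, h3, mul_comm]
  set w : G := ((i * M ^ 5) * (i * M ^ 2)) ^ (α : ℕ) * M ^ (c : ℕ) with hw
  have hφw := h.map_eta_pow_mul α c
  rcases hmc with ⟨h1, h2⟩ | ⟨h1, h2⟩
  · refine ⟨0, α, c, by omega, by omega, by omega, ?_⟩
    have := φ.eq_or_eq_neg hneg (g := g) (w := w) (by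
      have e : φ.toHom g = (-1 : ℂ) ^ (m : ℕ) •
          !![z ^ (5 * (α : ℕ)), 0; 0, z ^ (2 * (α : ℕ) + c)] := by
        rw [hg, hmod _ _ h1, hmod _ _ h2, hm3, hm3]
        ext i j; fin_cases i <;> fin_cases j <;> simp
      rw [e, hφw]
      exact hsign _ hm2 hs2)
    simpa [hw] using this
  · refine ⟨1, α, c, by omega, by omega, by omega, ?_⟩
    have := φ.eq_or_eq_neg hneg (g := g) (w := i * w * i) (by
      have e : φ.toHom g = (-1 : ℂ) ^ (m : ℕ) •
          !![z ^ (2 * (α : ℕ) + c), 0; 0, z ^ (5 * (α : ℕ))] := by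
        rw [hg, hmod _ _ h1, hmod _ _ h2, hm3, hm3]
        ext i j; fin_cases i <;> fin_cases j <;> simp
      rw [e, map_mul, map_mul, hφw, h.map_i, Matrix.mul_smul, Matrix.smul_mul,
        antidiagonal_mul_diagonal_mul]
      exact hsign _ hm2 hs2)
    simpa [hw, mul_assoc] using this

/-- Every element is, up to sign, one of the listed words. -/
theorem NormalForm.exists_word [Finite G] (h : NormalForm φ M i s z) (hi : i * i = 1)
    (hneg : ∀ g ∈ G, -g ∈ G) (g : G) :
    ∃ ε₁ ε₂ α c : ℕ, ε₁ ≤ 1 ∧ ε₂ ≤ 1 ∧ c ≤ 1 ∧ α ≤ 5 ∧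
      (g.val = i.val ^ ε₁ * ((i.val * M.val ^ 5) * (i.val * M.val ^ 2)) ^ α * M.val ^ c *
          i.val ^ ε₂ ∨
        g.val = -(i.val ^ ε₁ * ((i.val * M.val ^ 5) * (i.val * M.val ^ 2)) ^ α * M.val ^ c *
          i.val ^ ε₂)) := by
  rcases h.diagonal_or_diagonal_mul g with ⟨j, hj, k, hk, hg⟩ | ⟨j, hj, k, hk, hg⟩
  · obtain ⟨ε, α, c, hε, hc, hα, hw⟩ := h.exists_word_of_diagonal hneg hj hk hg
    exact ⟨ε, ε, α, c, hε, hε, hc, hα, hw⟩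
  · obtain ⟨ε, α, c, hε, hc, hα, hw⟩ := h.exists_word_of_diagonal hneg hj hk hg
    have hi' : i.val * i.val = 1 := congrArg Subtype.val hi
    have hshift : i.val ^ ε * i.val = i.val ^ (1 - ε) := by
      interval_cases ε <;> simp [hi']
    have hgi : g.val = (g * i).val * i.val := by simp [mul_assoc, hi']
    refine ⟨ε, 1 - ε, α, c, hε, by omega, hc, hα, ?_⟩
    rw [← hshift, hgi, ← mul_assoc (_ * _) (i.val ^ ε), ← neg_mul]
    exact hw.imp (congrArg (· * i.val)) (congrArg (· * i.val))

/-- All diagonal matrices of sixth roots of unity are in the image. -/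
theorem NormalForm.exists_diagonal (h : NormalForm φ M i s z) (hneg : ∀ g ∈ G, -g ∈ G)
    {a d : ℂ} (ha : ∃ j : ℕ, z ^ j = a) (hd : ∃ k : ℕ, z ^ k = d) :
    ∃ g : G, φ.toHom g = !![a, 0; 0, d] := by
  obtain ⟨j, rfl⟩ := ha
  obtain ⟨k, rfl⟩ := hd
  obtain ⟨m, hm⟩ : ∃ m : G, φ.toHom m = !![1, 0; 0, z] := by
    rcases sq_eq_sq_iff_eq_or_eq_neg.1 (h.s_sq.trans (one_pow 2).symm) with hs | hs
    · exact ⟨M, by rw [h.map_M, hs]; simp⟩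
    · refine ⟨⟨-M.val, hneg _ M.2⟩, ?_⟩
      rw [φ.map_neg M _ rfl, h.map_M, hs]
      ext i j; fin_cases i <;> fin_cases j <;> simp
  refine ⟨(i * m * i) ^ j * m ^ k, ?_⟩
  rw [map_mul, map_pow, map_pow, map_mul, map_mul, hm, h.map_i, antidiagonal_mul_diagonal_mul,
    diagonal_pow, diagonal_pow]
  ext i j; fin_cases i <;> fin_cases j <;> simp

theorem NormalForm.exists_antidiagonal (h : NormalForm φ M i s z) (hneg : ∀ g ∈ G, -g ∈ G)
    {b c : ℂ} (hb : ∃ j : ℕ, z ^ j = b) (hc : ∃ k : ℕ, z ^ k = c) :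
    ∃ g : G, φ.toHom g = !![0, b; c, 0] := by
  obtain ⟨g, hg⟩ := h.exists_diagonal hneg hb hc
  refine ⟨g * i, ?_⟩
  rw [map_mul, hg, h.map_i]
  ext i j; fin_cases i <;> fin_cases j <;> simp

/-- The non-commutation relations characterising type III, for diagonal elements. -/
theorem NormalForm.mul_ne_of_diagonal (h : NormalForm φ M i s z) {g : G} {a d : ℂ}
    (hg : φ.toHom g = !![a, 0; 0, d]) (hne : a ^ 2 ≠ d ^ 2) :
    i.val * g.val ≠ g.val * i.val ∧ i.val * g.val ≠ -(g.val * i.val) := by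
  constructor
  · intro e
    have e' : i * g = g * i := Subtype.ext e
    have := congrArg φ.toHom e'
    rw [map_mul, map_mul, hg, h.map_i] at this
    have h1 := congrFun (congrFun this 0) 1
    simp at h1
    exact hne (by rw [h1])
  · intro e
    have := φ.map_neg (g * i) (i * g) e
    rw [map_mul, map_mul, hg, h.map_i] at this
    have h1 := congrFun (congrFun this 0) 1
    simp at h1
    exact hne (by rw [h1]; ring)

/-- The non-commutation relations characterising type III, for antidiagonal elements. -/
theorem NormalForm.mul_ne_of_antidiagonal (h : NormalForm φ M i s z) {g : G} {b c : ℂ}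
    (hg : φ.toHom g = !![0, b; c, 0]) (hne : b ^ 2 ≠ c ^ 2) :
    i.val * g.val ≠ g.val * i.val ∧ i.val * g.val ≠ -(g.val * i.val) := by
  constructor
  · intro e
    have e' : i * g = g * i := Subtype.ext e
    have := congrArg φ.toHom e'
    rw [map_mul, map_mul, hg, h.map_i] at this
    have h1 := congrFun (congrFun this 0) 0
    simp at h1
    exact hne (by rw [h1])
  · intro e
    have := φ.map_neg (g * i) (i * g) e
    rw [map_mul, map_mul, hg, h.map_i] at this
    have h1 := congrFun (congrFun this 0) 0
    simp at h1
    exact hne (by rw [h1]; ring)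

end monomial

theorem aeval_diagonal (a d : ℂ) (p : ℚ[X]) :
    aeval !![a, 0; 0, d] p = !![aeval a p, 0; 0, aeval d p] := by
  induction p using Polynomial.induction_on' with
  | add p q hp hq => simp [hp, hq]
  | monomial n r =>
    rw [aeval_monomial, aeval_monomial, aeval_monomial, diagonal_pow]
    ext i j; fin_cases i <;> fin_cases j <;>
      simp [Matrix.mul_apply, Matrix.algebraMap_matrix_apply]

theorem minpoly_diagonal {a d : ℂ} {p : ℚ[X]} (hp : p.Monic) (hdvd : p ∣ X ^ 12 - 1)
    (ha : aeval a p = 0) (hd : aeval d p = 0)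
    (hroots : ∀ x : ℂ, aeval x p = 0 →
      (x = a ∨ x = d) ∨ (starRingEnd ℂ) x = a ∨ (starRingEnd ℂ) x = d) :
    minpoly ℚ !![a, 0; 0, d] = p := by
  refine minpoly_eq_of_roots hp hdvd ?_ fun x hx => ?_
  · rw [aeval_diagonal, ha, hd]
    ext i j; fin_cases i <;> fin_cases j <;> rfl
  · have hdet : ∀ y : ℂ, y = a ∨ y = d → (!![a, 0; 0, d] - y • (1 : Matrix (Fin 2) (Fin 2) ℂ)).det = 0 := by
      rintro y (rfl | rfl) <;> simp [det_fin_two]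
    exact (hroots x hx).imp (hdet _) (hdet _)

/-- An antidiagonal matrix has scalar square, so only polynomials in `X ^ 2` matter. -/
theorem minpoly_antidiagonal {b c : ℂ} {p : ℚ[X]} (hp : (expand ℚ 2 p).Monic)
    (hdvd : expand ℚ 2 p ∣ X ^ 12 - 1) (h : aeval (b * c) p = 0)
    (hroots : ∀ x : ℂ, aeval (x ^ 2) p = 0 → x ^ 2 = b * c ∨ (starRingEnd ℂ) x ^ 2 = b * c) :
    minpoly ℚ !![0, b; c, 0] = expand ℚ 2 p := by
  refine minpoly_eq_of_roots hp hdvd ?_ fun x hx => ?_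
  · have hsq : !![0, b; c, 0] ^ 2 = !![b * c, 0; 0, b * c] := by
      rw [pow_two]; ext i j; fin_cases i <;> fin_cases j <;> simp [mul_comm]
    rw [expand_aeval, hsq, aeval_diagonal, h]
    ext i j; fin_cases i <;> fin_cases j <;> rfl
  · have hdet : ∀ y : ℂ, y ^ 2 = b * c →
        (!![0, b; c, 0] - y • (1 : Matrix (Fin 2) (Fin 2) ℂ)).det = 0 := by
      intro y hy
      simp [det_fin_two]
      linear_combination hy
    rw [expand_aeval] at hx
    exact (hroots x hx).imp (hdet _) (hdet _)

/-! ### Elements with prescribed minimal polynomials -/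

section

variable {G : Subgroup GL4} {φ : PlaneRep G} {M i : G} {s z : ℂ}

theorem conj_eq_one_sub (hz : z ^ 2 - z + 1 = 0) : (starRingEnd ℂ) z = 1 - z := by
  have h1 : (starRingEnd ℂ) z * z = 1 := by
    rw [← Complex.normSq_eq_conj_mul_self, normSq_eq_one_of_pow_six (pow_sixth hz).2.2.2.2,
      Complex.ofReal_one]
  have hz0 : z ≠ 0 := by rintro rfl; norm_num at hz
  apply mul_right_cancel₀ hz0
  linear_combination h1 + hz

theorem linear_ne_zero (hz : z ^ 2 - z + 1 = 0) : z + 1 ≠ 0 ∧ 2 * z - 1 ≠ 0 ∧ z - 2 ≠ 0 := by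
  refine ⟨fun h => ?_, fun h => ?_, fun h => ?_⟩
  · have : (3 : ℂ) = 0 := by linear_combination (2 - z) * h + hz
    norm_num at this
  · have : (3 : ℂ) = 0 := by linear_combination -(2 * z - 1) * h + 4 * hz
    norm_num at this
  · have : (3 : ℂ) = 0 := by linear_combination -(z + 1) * h + hz
    norm_num at this

theorem NormalForm.exists_diagonal_minPoly (h : NormalForm φ M i s z) (hneg : ∀ g ∈ G, -g ∈ G)
    {a d : ℂ} {p : ℚ[X]} (ha : ∃ j : ℕ, z ^ j = a) (hd : ∃ k : ℕ, z ^ k = d)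
    (hne : a ^ 2 ≠ d ^ 2) (hp : p.Monic) (hdvd : p ∣ X ^ 12 - 1)
    (hpa : aeval a p = 0) (hpd : aeval d p = 0)
    (hroots : ∀ x : ℂ, aeval x p = 0 →
      (x = a ∨ x = d) ∨ (starRingEnd ℂ) x = a ∨ (starRingEnd ℂ) x = d) :
    ∃ g : G, φ.toHom g = !![a, 0; 0, d] ∧
      (i.val * g.val ≠ g.val * i.val ∧ i.val * g.val ≠ -(g.val * i.val)) ∧ minPoly g.val = p := by
  obtain ⟨g, hg⟩ := h.exists_diagonal hneg ha hd
  exact ⟨g, hg, h.mul_ne_of_diagonal hg hne,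
    by rw [φ.minPoly_eq, hg, minpoly_diagonal hp hdvd hpa hpd hroots]⟩

theorem NormalForm.exists_antidiagonal_minPoly (h : NormalForm φ M i s z)
    (hneg : ∀ g ∈ G, -g ∈ G) {b c : ℂ} {p : ℚ[X]} (hb : ∃ j : ℕ, z ^ j = b)
    (hc : ∃ k : ℕ, z ^ k = c) (hne : b ^ 2 ≠ c ^ 2) (hp : (expand ℚ 2 p).Monic)
    (hdvd : expand ℚ 2 p ∣ X ^ 12 - 1) (hpb : aeval (b * c) p = 0)
    (hroots : ∀ x : ℂ, aeval (x ^ 2) p = 0 → x ^ 2 = b * c ∨ (starRingEnd ℂ) x ^ 2 = b * c) :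
    ∃ g : G, φ.toHom g = !![0, b; c, 0] ∧
      (i.val * g.val ≠ g.val * i.val ∧ i.val * g.val ≠ -(g.val * i.val)) ∧
        minPoly g.val = expand ℚ 2 p := by
  obtain ⟨g, hg⟩ := h.exists_antidiagonal hneg hb hc
  exact ⟨g, hg, h.mul_ne_of_antidiagonal hg hne,
    by rw [φ.minPoly_eq, hg, minpoly_antidiagonal hp hdvd hpb hroots]⟩

/-- The square of an element acting antidiagonally acts as a scalar. -/
theorem NormalForm.mul_sq_eq_of_antidiagonal (h : NormalForm φ M i s z) {g : G} {b c : ℂ}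
    (hg : φ.toHom g = !![0, b; c, 0]) : i.val * g.val ^ 2 = g.val ^ 2 * i.val := by
  have : i * g ^ 2 = g ^ 2 * i := by
    apply φ.injective
    rw [map_mul, map_mul, map_pow, hg, h.map_i, pow_two]
    ext i j; fin_cases i <;> fin_cases j <;> simp [mul_comm]
  exact congrArg Subtype.val this

/-- The polynomials `X² ± 1` come from antidiagonal elements, whose square is the product of the
two entries; the others come from diagonal elements whose entries, together with their conjugates,
are all the roots. -/
theorem NormalForm.exists_minPoly (h : NormalForm φ M i s z) (hneg : ∀ g ∈ G, -g ∈ G) :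
    ∀ p ∈ ({X ^ 2 + 1, X ^ 3 + 1, X ^ 3 - 1,
        X ^ 3 + 2 * X ^ 2 + 2 * X + 1, X ^ 3 - 2 * X ^ 2 + 2 * X - 1,
        X ^ 2 - 1, X ^ 2 + X + 1, X ^ 2 - X + 1} : Set ℚ[X]),
      ∃ g : G, (i.val * g.val ≠ g.val * i.val ∧ i.val * g.val ≠ -(g.val * i.val)) ∧
        minPoly g.val = p := by
  have hz := h.z_sq
  -- the six powers of `z` as linear polynomials in `z`
  obtain ⟨hz2, hz3, hz4, hz5, -⟩ := pow_sixth hz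
  have hc := conj_eq_one_sub hz
  obtain ⟨hn1, hn2, hn3⟩ := linear_ne_zero hz
  have e0 : ∃ j : ℕ, z ^ j = 1 := ⟨0, pow_zero z⟩
  have e1 : ∃ j : ℕ, z ^ j = z := ⟨1, pow_one z⟩
  have e2 : ∃ j : ℕ, z ^ j = z - 1 := ⟨2, hz2⟩
  have e3 : ∃ j : ℕ, z ^ j = -1 := ⟨3, hz3⟩
  have e4 : ∃ j : ℕ, z ^ j = -z := ⟨4, hz4⟩
  have e5 : ∃ j : ℕ, z ^ j = 1 - z := ⟨5, hz5⟩
  rintro p (rfl | rfl | rfl | rfl | rfl | rfl | rfl | rfl)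
  · have ep : (X ^ 2 + 1 : ℚ[X]) = expand ℚ 2 (X + 1) := by simp
    rw [ep]
    obtain ⟨g, -, hg⟩ := h.exists_antidiagonal_minPoly hneg (p := X + 1) e1 e2
      (fun e => hn2 (by linear_combination e)) (ep ▸ by monicity!)
      (ep ▸ ⟨(X ^ 2 - 1) * (X ^ 8 + X ^ 4 + 1), by ring⟩)
      (by simp; linear_combination hz)
      (fun x hx => .inl (by simp at hx; linear_combination hx - hz))
    exact ⟨g, hg⟩
  · obtain ⟨g, -, hg⟩ := h.exists_diagonal_minPoly hneg (p := X ^ 3 + 1) e3 e5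
      (fun e => hn1 (by linear_combination e + hz)) (by monicity!)
      ⟨(X ^ 3 - 1) * (X ^ 6 + 1), by ring⟩ (by simp; norm_num)
      (by simp; linear_combination (2 - z) * hz) (by
        intro x hx
        simp only [map_add, map_pow, aeval_X, map_one] at hx
        have hx' : (x + 1) * ((x - (1 - z)) * (x - z)) = 0 := by
          linear_combination hx - (x + 1) * hz
        rcases mul_eq_zero.1 hx' with h | h
        · exact .inl (.inl (eq_neg_of_add_eq_zero_left h))
        rcases mul_eq_zero.1 h with h | h
        · exact .inl (.inr (sub_eq_zero.1 h))
        · exact .inr (.inr (by rw [sub_eq_zero.1 h, hc])))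
    exact ⟨g, hg⟩
  · obtain ⟨g, -, hg⟩ := h.exists_diagonal_minPoly hneg (p := X ^ 3 - 1) e0 e2
      (fun e => hn1 (by linear_combination e + hz)) (by monicity!)
      ⟨(X ^ 3 + 1) * (X ^ 6 + 1), by ring⟩ (by simp)
      (by simp; linear_combination (z - 2) * hz) (by
        intro x hx
        simp only [map_sub, map_pow, aeval_X, map_one] at hx
        have hx' : (x - 1) * ((x - (z - 1)) * (x + z)) = 0 := by
          linear_combination hx - (x - 1) * hz
        rcases mul_eq_zero.1 hx' with h | h
        · exact .inl (.inl (sub_eq_zero.1 h))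
        rcases mul_eq_zero.1 h with h | h
        · exact .inl (.inr (sub_eq_zero.1 h))
        · exact .inr (.inr (by rw [eq_neg_of_add_eq_zero_left h, map_neg, hc]; ring)))
    exact ⟨g, hg⟩
  · obtain ⟨g, -, hg⟩ := h.exists_diagonal_minPoly hneg (p := X ^ 3 + 2 * X ^ 2 + 2 * X + 1) e3 e4
      (fun e => hn3 (by linear_combination -e - hz)) (by monicity!)
      ⟨(X - 1) * (X ^ 2 - X + 1) * (X ^ 6 + 1), by ring⟩ (by simp [map_ofNat]; norm_num)
      (by simp [map_ofNat]; linear_combination (1 - z) * hz) (by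
        intro x hx
        simp [map_ofNat] at hx
        have hx' : (x + 1) * ((x - (z - 1)) * (x + z)) = 0 := by
          linear_combination hx - (x + 1) * hz
        rcases mul_eq_zero.1 hx' with h | h
        · exact .inl (.inl (eq_neg_of_add_eq_zero_left h))
        rcases mul_eq_zero.1 h with h | h
        · exact .inr (.inr (by rw [sub_eq_zero.1 h, map_sub, hc, map_one]; ring))
        · exact .inl (.inr (eq_neg_of_add_eq_zero_left h)))
    exact ⟨g, hg⟩
  · obtain ⟨g, -, hg⟩ := h.exists_diagonal_minPoly hneg (p := X ^ 3 - 2 * X ^ 2 + 2 * X - 1) e0 e1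
      (fun e => hn3 (by linear_combination -e - hz)) (by monicity!)
      ⟨(X + 1) * (X ^ 2 + X + 1) * (X ^ 6 + 1), by ring⟩ (by simp [map_ofNat])
      (by simp [map_ofNat]; linear_combination (z - 1) * hz) (by
        intro x hx
        simp [map_ofNat] at hx
        have hx' : (x - 1) * ((x - (1 - z)) * (x - z)) = 0 := by
          linear_combination hx - (x - 1) * hz
        rcases mul_eq_zero.1 hx' with h | h
        · exact .inl (.inl (sub_eq_zero.1 h))
        rcases mul_eq_zero.1 h with h | h
        · exact .inr (.inr (by rw [sub_eq_zero.1 h, map_sub, hc, map_one]; ring))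
        · exact .inl (.inr (sub_eq_zero.1 h)))
    exact ⟨g, hg⟩
  · have ep : (X ^ 2 - 1 : ℚ[X]) = expand ℚ 2 (X - 1) := by simp
    rw [ep]
    obtain ⟨g, -, hg⟩ := h.exists_antidiagonal_minPoly hneg (p := X - 1) e1 e5
      (fun e => hn2 (by linear_combination e)) (ep ▸ by monicity!)
      (ep ▸ ⟨(X ^ 4 + X ^ 2 + 1) * (X ^ 6 + 1), by ring⟩)
      (by simp; linear_combination -hz)
      (fun x hx => .inl (by simp at hx; linear_combination hx + hz))
    exact ⟨g, hg⟩
  · obtain ⟨g, -, hg⟩ := h.exists_diagonal_minPoly hneg (p := X ^ 2 + X + 1) e2 e4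
      (fun e => hn2 (by linear_combination -e)) (by monicity!)
      ⟨(X - 1) * (X ^ 3 + 1) * (X ^ 6 + 1), by ring⟩ (by simp; linear_combination hz)
      (by simp; linear_combination hz) (by
        intro x hx
        simp at hx
        have hx' : (x - (z - 1)) * (x + z) = 0 := by linear_combination hx - hz
        rcases mul_eq_zero.1 hx' with h | h
        · exact .inl (.inl (sub_eq_zero.1 h))
        · exact .inl (.inr (eq_neg_of_add_eq_zero_left h)))
    exact ⟨g, hg⟩
  · obtain ⟨g, -, hg⟩ := h.exists_diagonal_minPoly hneg (p := X ^ 2 - X + 1) e1 e5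
      (fun e => hn2 (by linear_combination e)) (by monicity!)
      ⟨(X + 1) * (X ^ 3 - 1) * (X ^ 6 + 1), by ring⟩ (by simp; linear_combination hz)
      (by simp; linear_combination hz) (by
        intro x hx
        simp at hx
        have hx' : (x - z) * (x - (1 - z)) = 0 := by linear_combination hx - hz
        rcases mul_eq_zero.1 hx' with h | h
        · exact .inl (.inl (sub_eq_zero.1 h))
        · exact .inl (.inr (sub_eq_zero.1 h)))
    exact ⟨g, hg⟩

/-- The witness is `diag(z, z²)`, with square `diag(z², z⁴)`. -/
theorem NormalForm.exists_minPoly_quartic_diagonal (h : NormalForm φ M i s z)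
    (hneg : ∀ g ∈ G, -g ∈ G) :
    ∃ g : G, (i.val * g.val ≠ g.val * i.val ∧ i.val * g.val ≠ -(g.val * i.val)) ∧
      minPoly g.val = X ^ 4 + X ^ 2 + 1 ∧
      (i.val * g.val ^ 2 ≠ g.val ^ 2 * i.val ∧ i.val * g.val ^ 2 ≠ -(g.val ^ 2 * i.val)) := by
  have hz := h.z_sq
  have hc := conj_eq_one_sub hz
  obtain ⟨-, hn2, -⟩ := linear_ne_zero hz
  obtain ⟨g, hg, hg1, hg2⟩ := h.exists_diagonal_minPoly hneg (p := X ^ 4 + X ^ 2 + 1)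
    (a := z) (d := z - 1) ⟨1, pow_one z⟩ ⟨2, (pow_sixth hz).1⟩
    (fun e => hn2 (by linear_combination e)) (by monicity!)
    ⟨(X ^ 2 - 1) * (X ^ 6 + 1), by ring⟩
    (by simp; linear_combination (z ^ 2 + z + 1) * hz)
    (by simp; linear_combination (z ^ 2 - 3 * z + 3) * hz) (by
      intro x hx
      simp at hx
      have hx' : ((x - z) * (x - (1 - z))) * ((x - (z - 1)) * (x + z)) = 0 := by
        linear_combination hx + (z ^ 2 - z - 1 - 2 * x ^ 2) * hz
      rcases mul_eq_zero.1 hx' with h | h <;> rcases mul_eq_zero.1 h with h | h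
      · exact .inl (.inl (sub_eq_zero.1 h))
      · exact .inr (.inl (by rw [sub_eq_zero.1 h, map_sub, hc, map_one]; ring))
      · exact .inl (.inr (sub_eq_zero.1 h))
      · exact .inr (.inr (by rw [eq_neg_of_add_eq_zero_left h, map_neg, hc]; ring)))
  refine ⟨g, hg1, hg2, ?_⟩
  refine h.mul_ne_of_diagonal (g := g ^ 2) (a := z ^ 2) (d := (z - 1) ^ 2)
    (by rw [map_pow, hg, diagonal_pow]) fun e => hn2 ?_
  linear_combination -e + (4 * z - 2) * hz

/-- The witnesses are antidiagonal with entries `1, z²` and `1, z`, so their squares are the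
scalars `z²` and `z`, which commute with `ι`. -/
theorem NormalForm.exists_minPoly_quartic_antidiagonal (h : NormalForm φ M i s z)
    (hneg : ∀ g ∈ G, -g ∈ G) :
    ∀ p ∈ ({X ^ 4 + X ^ 2 + 1, X ^ 4 - X ^ 2 + 1} : Set ℚ[X]),
      ∃ g : G, (i.val * g.val ≠ g.val * i.val ∧ i.val * g.val ≠ -(g.val * i.val)) ∧
        minPoly g.val = p ∧ i.val * g.val ^ 2 = g.val ^ 2 * i.val := by
  have hz := h.z_sq
  have hc := conj_eq_one_sub hz
  obtain ⟨hn1, -, hn3⟩ := linear_ne_zero hz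
  rintro p (rfl | rfl)
  · have ep : (X ^ 4 + X ^ 2 + 1 : ℚ[X]) = expand ℚ 2 (X ^ 2 + X + 1) := by simp; ring
    rw [ep]
    obtain ⟨g, hg, hg1, hg2⟩ := h.exists_antidiagonal_minPoly hneg (p := X ^ 2 + X + 1)
      (b := 1) (c := z - 1) ⟨0, pow_zero z⟩ ⟨2, (pow_sixth hz).1⟩
      (fun e => hn1 (by linear_combination e + hz)) (ep ▸ by monicity!)
      (ep ▸ ⟨(X ^ 2 - 1) * (X ^ 6 + 1), by ring⟩)
      (by simp; linear_combination hz) (by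
        intro x hx
        simp at hx
        have hx' : (x ^ 2 - (z - 1)) * (x ^ 2 + z) = 0 := by linear_combination hx - hz
        rcases mul_eq_zero.1 hx' with h | h
        · exact .inl (by linear_combination h)
        · exact .inr (by rw [← map_pow, eq_neg_of_add_eq_zero_left h, map_neg, hc]; ring))
    exact ⟨g, hg1, hg2, h.mul_sq_eq_of_antidiagonal hg⟩
  · have ep : (X ^ 4 - X ^ 2 + 1 : ℚ[X]) = expand ℚ 2 (X ^ 2 - X + 1) := by simp; ring
    rw [ep]
    obtain ⟨g, hg, hg1, hg2⟩ := h.exists_antidiagonal_minPoly hneg (p := X ^ 2 - X + 1)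
      (b := 1) (c := z) ⟨0, pow_zero z⟩ ⟨1, pow_one z⟩
      (fun e => hn3 (by linear_combination -e - hz)) (ep ▸ by monicity!)
      (ep ▸ ⟨(X ^ 2 + 1) * (X ^ 6 - 1), by ring⟩)
      (by simp; linear_combination hz) (by
        intro x hx
        simp at hx
        have hx' : (x ^ 2 - z) * (x ^ 2 - (1 - z)) = 0 := by linear_combination hx - hz
        rcases mul_eq_zero.1 hx' with h | h
        · exact .inl (by linear_combination h)
        · exact .inr (by rw [← map_pow, sub_eq_zero.1 h, map_sub, hc, map_one]; ring))
    exact ⟨g, hg1, hg2, h.mul_sq_eq_of_antidiagonal hg⟩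

end

end Holonomy

theorem theorem9p5 (S : SurfaceData) (hS : S.IsGhol)
    (hτ : ∀ i, S.τ i ∈ SurfaceData.QSqrtNegThree)
    (M : GL4) (hM : M ∈ S.typeGroup) (hMIII : IsTypeIII M)
    (hmin : minPoly M = X ^ 3 + 2 * X ^ 2 + 2 * X + 1 ∨
      minPoly M = X ^ 3 - 2 * X ^ 2 + 2 * X - 1) :
    -- the group of Type I-III elements is generated by `M` and `±ι`
    S.typeGroup = Subgroup.closure {M, iota, -iota} ∧
    -- it contains all Type III automorphisms
    (∀ N ∈ S.Aut, IsTypeIII N → N ∈ Subgroup.closure {M, iota, -iota}) ∧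
    -- and Type III automorphisms with each of the possible minimal polynomials
    (∀ p ∈ ({X ^ 2 + 1, X ^ 3 + 1, X ^ 3 - 1,
        X ^ 3 + 2 * X ^ 2 + 2 * X + 1, X ^ 3 - 2 * X ^ 2 + 2 * X - 1,
        X ^ 2 - 1, X ^ 2 + X + 1, X ^ 2 - X + 1} : Set ℚ[X]),
      ∃ N ∈ S.typeGroup, IsTypeIII N ∧ minPoly N = p) ∧
    (∃ N ∈ S.typeGroup, IsTypeIII N ∧ minPoly N = X ^ 4 + X ^ 2 + 1 ∧ IsTypeIII (N ^ 2)) ∧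
    (∃ N ∈ S.typeGroup, IsTypeIII N ∧ minPoly N = X ^ 4 + X ^ 2 + 1 ∧ IsTypeI (N ^ 2)) ∧
    (∃ N ∈ S.typeGroup, IsTypeIII N ∧ minPoly N = X ^ 4 - X ^ 2 + 1 ∧ IsTypeI (N ^ 2)) ∧
    -- and its elements are listed explicitly
    (S.typeGroup : Set GL4) =
      {g | ∃ ε₁ ε₂ α₁ α₂ : ℕ, ε₁ ≤ 1 ∧ ε₂ ≤ 1 ∧ α₂ ≤ 1 ∧ α₁ ≤ 5 ∧
        (g = iota ^ ε₁ * eta M ^ α₁ * M ^ α₂ * iota ^ ε₂ ∨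
         g = -(iota ^ ε₁ * eta M ^ α₁ * M ^ α₂ * iota ^ ε₂))} := by
  have hfin : Finite S.typeGroup :=
    (hS.finite_subgroups _ (hS.typeGroup_eq.le.trans inf_le_left)).to_subtype
  have hι : iota ∈ S.typeGroup := Subgroup.subset_closure ⟨hS.iota_mem, .inl isTypeI_iota⟩
  have hnι : -iota ∈ S.typeGroup :=
    Subgroup.subset_closure ⟨hS.neg_iota_mem, .inl isTypeI_neg_iota⟩
  have hιι : iota * iota = 1 := by
    apply Units.ext
    simp [iota, fromBlocks_multiply]
  -- any subgroup containing `ι` and `-ι` contains `-1`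
  have hneg_of : ∀ H : Subgroup GL4, iota ∈ H → -iota ∈ H → ∀ g ∈ H, -g ∈ H := by
    intro H h1 h2 g hg
    have h := H.mul_mem (H.mul_mem h1 h2) hg
    rwa [mul_neg, hιι, neg_mul, one_mul] at h
  have hneg := hneg_of _ hι hnι
  have htype : ∀ N ∈ S.typeGroup, IsTypeI N ∨ IsTypeII N ∨ IsTypeIII N := fun N hN =>
    isType_of_mem_symplectic (fun i => (hS.im_pos i).ne')
      (hS.val_mem_tangentAlgebra (hS.typeGroup_eq.le hN).1) (hS.typeGroup_eq.le hN).2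
  have hcomm : (⟨iota, hι⟩ : S.typeGroup) * ⟨M, hM⟩ ≠ ⟨M, hM⟩ * ⟨iota, hι⟩ := fun h =>
    hMIII.1.2.1 (by rw [A₂_eq_zero_of_iota_mul (congrArg Subtype.val h)]; simp)
  obtain ⟨s, φ, z, hφ⟩ : ∃ (s : ℚ) (φ : PlaneRep S.typeGroup) (z : ℂ),
      NormalForm φ ⟨M, hM⟩ ⟨iota, hι⟩ s z := by
    rcases hmin with hmin | hmin
    · exact ⟨-1, exists_normalForm (hS.planeRep hτ) ⟨M, hM⟩ ⟨iota, hι⟩ (Subtype.ext hιι) hcomm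
        (by norm_num) (by rw [hmin]; simp; ring)⟩
    · exact ⟨1, exists_normalForm (hS.planeRep hτ) ⟨M, hM⟩ ⟨iota, hι⟩ (Subtype.ext hιι) hcomm
        (by norm_num) (by rw [hmin]; simp; ring)⟩
  set W : Set GL4 := {g | ∃ ε₁ ε₂ α₁ α₂ : ℕ, ε₁ ≤ 1 ∧ ε₂ ≤ 1 ∧ α₂ ≤ 1 ∧ α₁ ≤ 5 ∧
        (g = iota ^ ε₁ * eta M ^ α₁ * M ^ α₂ * iota ^ ε₂ ∨
         g = -(iota ^ ε₁ * eta M ^ α₁ * M ^ α₂ * iota ^ ε₂))} with hW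
  have hGW : (S.typeGroup : Set GL4) ⊆ W := fun g hg => by
    obtain ⟨ε₁, ε₂, α, c, h1, h2, h3, h4, h⟩ := hφ.exists_word (Subtype.ext hιι) hneg ⟨g, hg⟩
    exact ⟨ε₁, ε₂, α, c, h1, h2, h3, h4, h⟩
  have hWcl : W ⊆ (Subgroup.closure {M, iota, -iota} : Subgroup GL4) := by
    have hMc : M ∈ Subgroup.closure {M, iota, -iota} := Subgroup.subset_closure (by simp)
    have hιc : iota ∈ Subgroup.closure {M, iota, -iota} := Subgroup.subset_closure (by simp)
    have hnc : -iota ∈ Subgroup.closure {M, iota, -iota} := Subgroup.subset_closure (by simp)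
    rintro g ⟨ε₁, ε₂, α₁, α₂, -, -, -, -, h⟩
    have hw : iota ^ ε₁ * eta M ^ α₁ * M ^ α₂ * iota ^ ε₂ ∈
        Subgroup.closure {M, iota, -iota} := by
      unfold Holonomy.eta
      exact mul_mem (mul_mem (mul_mem (pow_mem hιc _) (pow_mem (mul_mem (mul_mem hιc
        (pow_mem hMc _)) (mul_mem hιc (pow_mem hMc _))) _)) (pow_mem hMc _)) (pow_mem hιc _)
    rcases h with rfl | rfl
    exacts [hw, hneg_of _ hιc hnc _ hw]
  have hclG : Subgroup.closure {M, iota, -iota} ≤ S.typeGroup := by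
    rw [Subgroup.closure_le]
    rintro g (rfl | rfl | rfl)
    exacts [hM, hι, hnι]
  have hG : S.typeGroup = Subgroup.closure {M, iota, -iota} := le_antisymm (hGW.trans hWcl) hclG
  have hIII : ∀ N ∈ S.typeGroup, (iota * N ≠ N * iota ∧ iota * N ≠ -(N * iota)) →
      IsTypeIII N := fun N hN hne => isTypeIII_of_iota_mul_ne (htype N hN) hne.1 hne.2
  refine ⟨hG, fun N hN hN3 => hG ▸ Subgroup.subset_closure ⟨hN, .inr (.inr hN3)⟩, ?_, ?_, ?_, ?_,
    hGW.antisymm (hWcl.trans hclG)⟩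
  · intro p hp
    obtain ⟨g, hg, hgp⟩ := hφ.exists_minPoly hneg p hp
    exact ⟨g, g.2, hIII g g.2 hg, hgp⟩
  · obtain ⟨g, hg, hgp, hg2⟩ := hφ.exists_minPoly_quartic_diagonal hneg
    exact ⟨g, g.2, hIII g g.2 hg, hgp, hIII _ (pow_mem g.2 2) hg2⟩
  · obtain ⟨g, hg, hgp, hg2⟩ := hφ.exists_minPoly_quartic_antidiagonal hneg _ (.inl rfl)
    exact ⟨g, g.2, hIII g g.2 hg, hgp, isTypeI_of_iota_mul_eq (htype _ (pow_mem g.2 2)) hg2⟩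
  · obtain ⟨g, hg, hgp, hg2⟩ := hφ.exists_minPoly_quartic_antidiagonal hneg _ (.inr rfl)
    exact ⟨g, g.2, hIII g g.2 hg, hgp, isTypeI_of_iota_mul_eq (htype _ (pow_mem g.2 2)) hg2⟩
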